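/- \textbf{Setting.} Consider $x_{t+1}=f(x_t,u_t,w_t)$ with $x_t\in\mathbb R^n$, $u_t\in\mathbb R^m$, a fixed (adversarial) noise sequence $w_t\in\mathbb R^g$ with $\|w_t\|\le w_{\max}$, $w_{\max}>0$, and a pool of controllers $\pi_1,\dots,\pi_N:\mathbb R^n\to\mathbb R^m$. On $\|w\|,\|w'\|\le w_{\max}$, $\|f(x,u,w)-f(x',u',w')\|\le L_f(\|x-x'\|+\|u-u'\|+\|w-w'\|)$ with $L_f\ge1$, and $\|f(0,0,0)\|\le f_0$. The costs satisfy $c_t\ge 0$, $|c_t(x,u)-c_t(x',u')|\le (L_{c1}(\max\{\|x\|,\|x'\|\}+\max\{\|u\|,\|u'\|\})+L_{c2})(\|x-x'\|+\|u-u'\|)$ with $L_{c1},L_{c2}>0$, and $|c_t(0,0)|\le c_{0,\max}$. All $\pi_i$ are $L_\pi$-Lipschitz with $\|\pi_i(0)\|\le\pi_{0,\max}$, and $\|x_0\|\le x_{0,\max}$. Fix $\gamma>0$ and a non-increasing $\beta:\mathbb Z_{\ge0}\to\mathbb R$ with $\beta(0)=1$, $\beta(t)\to0$, and put $H(t)=\sum_{i=0}^{t-1}\beta(i)$.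 A controller $\pi$ is input-to-state stable if $\|x_t\|\le\beta(t)\|x_0\|+\gamma w_{\max}$ for all $t$, all initial states and all noise sequences bounded by $w_{\max}$, along $x_{t+1}=f(x_t,\pi(x_t),w_t)$; it is incrementally stable if $\|x_t-\tilde x_t\|\le\beta(t)\|x_0-\tilde x_0\|$ for any two such trajectories with the same noise. Let $\mathcal U$ be the set of controllers in the pool that are not input-to-state stable, $\mathcal S$ the set of those that are both input-to-state and incrementally stable; assume $\mathcal S\ne\emptyset$. Let $(x_t^*,u_t^*)$ be the trajectory, from $x_0$ and with the same noise, of a controller in $\mathcal S$ that minimizes $\sum_{t=0}^Tc_t(x_t,u_t)$ over $\mathcal S$. \textbf{Dynamic Batching.} Inputs: $T$, $\eta_0>0$, batch lengths $(\tau_b)_{b\ge0}$, $\beta$, $\gamma$. Start with $t_0=0$, $\mathcal P_0=\{1,\dots,N\}$, $W_0=0$. In batch $b=0,1,\dots$, as long as $t_b\le T$: sample $K_b\in\mathcal P_b$ with probabilities $p_b(k)=e^{-\eta_0W_b(k)}/\sum_{i\in\mathcal P_b}e^{-\eta_0W_b(i)}$; for $t=t_b,\dots,\min(t_b+\tau_b-1,T)$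 apply $u_t=\pi_{K_b}(x_t)$ and observe $x_{t+1}$; if $\|x_{t+1}\|>\beta(t+1-t_b)\|x_{t_b}\|+\gamma w_{\max}$, remove $K_b$ from the pool ($\mathcal P_{b+1}=\mathcal P_b\setminus\{K_b\}$) and stop the batch (otherwise $\mathcal P_{b+1}=\mathcal P_b$). Let $t_{b+1}=t+1$ for the last $t$ of the batch, $w_b=\sum_{t=t_b}^{t_{b+1}-1}c_t(x_t,u_t)$, and $W_{b+1}(k)=W_b(k)+\frac{w_b}{p_b(k)}\mathbf 1_{\{k=K_b\}}$. Put $\mathrm{Regret}_T=\mathbb E\sum_{t=0}^T[c_t(x_t,u_t)-c_t(x_t^*,u_t^*)]$, with expectation over the random choices $K_b$. \textbf{Tuning.} Let $M=N(|\mathcal U|+1)$, $\tau_0=\lfloor(z/M)^{1/2}\rfloor$ and $\tau_b=\lceil((\nu b+z)/M)^{1/2}\rceil$ for $b\ge1$, where $\nu>0$ is a constant and $0<z\le\zeta M$ for a constant $\zeta>0$ (in particular, $z$ may be a constant), such that $\tau_0>0$ and $\frac{\tau_1}{\tau_0}\beta(\tau_0)^2<\frac1{2\sqrt2}$. Let $a_1\frac{(|\mathcal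 U|+1)^{2/3}}{T^{2/3}N^{1/3}}\le\eta_0\le a_2\frac{(|\mathcal U|+1)^{2/3}}{T^{2/3}N^{1/3}}$ with constants $0<a_1\le a_2$, and let $T\ge\max\{|\mathcal U|^{3/2}/M^{1/2},\,M\}$. \textbf{Claim.} Then \[\mathrm{Regret}_T\le\tilde O\big(T^{2/3}N^{1/3}(|\mathcal U|+1)^{1/3}\big)+o(T^{1/3})\exp(O(|\mathcal U|))+o(T).\] Moreover, if $H(t)\le O(\sum_{i=1}^t\frac1i)$ for all $t\ge1$, then \[\mathrm{Regret}_T\le\tilde O\big(T^{2/3}N^{1/3}(|\mathcal U|+1)^{1/3}\big)+o(T^{1/3})\exp(O(|\mathcal U|)).\] Here $\tilde O(X)$ means at most $C\,X\,(1+\log T)^p$, the $o(\cdot)$ are functions of $T$ alone as $T\to\infty$, $O(|\mathcal U|)$ means $c|\mathcal U|$, and the constants $C,p,c$ and the functions $o(\cdot)$ depend only on $w_{\max},L_f,f_0,L_{c1},L_{c2},c_{0,\max},L_\pi,\pi_{0,\max},x_{0,\max},\beta,\gamma,\nu,\zeta,a_1,a_2$; they do not depend on $N$, $|\mathcal U|$,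 $T$, the dimensions or the remaining data of the problem. -/

import Mathlib

open Filter Asymptotics

noncomputable section

/-- The constants of the control problem.  `β` and `γ` are the stability gains that are known to
the algorithm, `wMax` bounds the noise, `x0Max` the initial state, `f0` the vector `f(0,0,0)`. -/
structure ModelConstants where
  wMax : ℝ
  Lf : ℝ
  f0 : ℝ
  Lc1 : ℝ
  Lc2 : ℝ
  c0Max : ℝ
  Lπ : ℝ
  π0Max : ℝ
  x0Max : ℝ
  γ : ℝ
  β : ℕ → ℝ
  wMax_pos : 0 < wMax
  one_le_Lf : 1 ≤ Lf
  Lc1_pos : 0 < Lc1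
  Lc2_pos : 0 < Lc2
  c0Max_nonneg : 0 ≤ c0Max
  π0Max_nonneg : 0 ≤ π0Max
  γ_pos : 0 < γ
  β_antitone : Antitone β
  β_zero : β 0 = 1
  β_tendsto : Tendsto β atTop (nhds 0)

/-- `H(t) = ∑_{i=0}^{t-1} β(i)`. -/
def ModelConstants.H (κ : ModelConstants) (t : ℕ) : ℝ := ∑ i ∈ Finset.range t, κ.β i

/-- The closed-loop trajectory `x_{t+1} = f(x_t, π(x_t), w_t)` started at `x`. -/
def closedLoop {n m g : ℕ}
    (f : EuclideanSpace ℝ (Fin n) → EuclideanSpace ℝ (Fin m) → EuclideanSpace ℝ (Fin g) →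
      EuclideanSpace ℝ (Fin n))
    (π : EuclideanSpace ℝ (Fin n) → EuclideanSpace ℝ (Fin m))
    (w : ℕ → EuclideanSpace ℝ (Fin g)) (x : EuclideanSpace ℝ (Fin n)) :
    ℕ → EuclideanSpace ℝ (Fin n)
  | 0 => x
  | t + 1 => f (closedLoop f π w x t) (π (closedLoop f π w x t)) (w t)

/-- (Asymptotic) input-to-state stability of the controller `π`, with gains `β` and `γ`. -/
def IsISSController {n m g : ℕ} (κ : ModelConstants)
    (f : EuclideanSpace ℝ (Fin n) → EuclideanSpace ℝ (Fin m) → EuclideanSpace ℝ (Fin g) →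
      EuclideanSpace ℝ (Fin n))
    (π : EuclideanSpace ℝ (Fin n) → EuclideanSpace ℝ (Fin m)) : Prop :=
  ∀ (x : EuclideanSpace ℝ (Fin n)) (w : ℕ → EuclideanSpace ℝ (Fin g)),
    (∀ t, ‖w t‖ ≤ κ.wMax) →
      ∀ t, ‖closedLoop f π w x t‖ ≤ κ.β t * ‖x‖ + κ.γ * κ.wMax

/-- (Asymptotic) incremental stability of the controller `π`, with gain `β`. -/
def IsIncrementallyStableController {n m g : ℕ} (κ : ModelConstants)
    (f : EuclideanSpace ℝ (Fin n) → EuclideanSpace ℝ (Fin m) → EuclideanSpace ℝ (Fin g) →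
      EuclideanSpace ℝ (Fin n))
    (π : EuclideanSpace ℝ (Fin n) → EuclideanSpace ℝ (Fin m)) : Prop :=
  ∀ (x y : EuclideanSpace ℝ (Fin n)) (w : ℕ → EuclideanSpace ℝ (Fin g)),
    (∀ t, ‖w t‖ ≤ κ.wMax) →
      ∀ t, ‖closedLoop f π w x t - closedLoop f π w y t‖ ≤ κ.β t * ‖x - y‖

/-- The data of an online control problem with a pool of `N` candidate controllers: dynamics,
cost functions, controllers, the (adversarially fixed) noise sequence and the initial state. -/
structure ControlProblem (n m g N : ℕ) where
  f : EuclideanSpace ℝ (Fin n) → EuclideanSpace ℝ (Fin m) → EuclideanSpace ℝ (Fin g) →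
    EuclideanSpace ℝ (Fin n)
  cost : ℕ → EuclideanSpace ℝ (Fin n) → EuclideanSpace ℝ (Fin m) → ℝ
  policy : Fin N → EuclideanSpace ℝ (Fin n) → EuclideanSpace ℝ (Fin m)
  noise : ℕ → EuclideanSpace ℝ (Fin g)
  x0 : EuclideanSpace ℝ (Fin n)

/-- The state of the algorithm at the beginning of a batch: the start time `t_b`, the system state
`x_{t_b}`, the set `P_b` of controllers that have not been falsified, the weights `W_b`. -/
structure BatchState (n N : ℕ) where
  time : ℕ
  x : EuclideanSpace ℝ (Fin n)
  pool : Finset (Fin N)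
  W : Fin N → ℝ

namespace ControlProblem

variable {n m g N : ℕ}

/-- The standing assumptions on dynamics, costs, controllers, noise and initial state, with the
constants `κ`. -/
structure Admissible (P : ControlProblem n m g N) (κ : ModelConstants) : Prop where
  f_lipschitz : ∀ x x' u u' w w', ‖w‖ ≤ κ.wMax → ‖w'‖ ≤ κ.wMax →
    ‖P.f x u w - P.f x' u' w'‖ ≤ κ.Lf * (‖x - x'‖ + ‖u - u'‖ + ‖w - w'‖)
  f_zero : ‖P.f 0 0 0‖ ≤ κ.f0
  cost_nonneg : ∀ t x u, 0 ≤ P.cost t x u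
  cost_lipschitz : ∀ t x x' u u', |P.cost t x u - P.cost t x' u'| ≤
    (κ.Lc1 * (max ‖x‖ ‖x'‖ + max ‖u‖ ‖u'‖) + κ.Lc2) * (‖x - x'‖ + ‖u - u'‖)
  cost_zero : ∀ t, |P.cost t 0 0| ≤ κ.c0Max
  policy_lipschitz : ∀ i x x', ‖P.policy i x - P.policy i x'‖ ≤ κ.Lπ * ‖x - x'‖
  policy_zero : ∀ i, ‖P.policy i 0‖ ≤ κ.π0Max
  noise_bound : ∀ t, ‖P.noise t‖ ≤ κ.wMax
  x0_bound : ‖P.x0‖ ≤ κ.x0Max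

open Classical in
/-- The set `𝒰` of destabilizing controllers. -/
def destabilizing (P : ControlProblem n m g N) (κ : ModelConstants) : Finset (Fin N) :=
  Finset.univ.filter fun i => ¬ IsISSController κ P.f (P.policy i)

open Classical in
/-- The set `𝒮` of stabilizing controllers. -/
def stabilizing (P : ControlProblem n m g N) (κ : ModelConstants) : Finset (Fin N) :=
  Finset.univ.filter fun i =>
    IsISSController κ P.f (P.policy i) ∧ IsIncrementallyStableController κ P.f (P.policy i)

/-- The total cost over `t = 0, …, T` if controller `i` is used all the time. -/
def fixedCost (P : ControlProblem n m g N) (T : ℕ) (i : Fin N) : ℝ :=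
  ∑ t ∈ Finset.range (T + 1),
    P.cost t (closedLoop P.f (P.policy i) P.noise P.x0 t)
      (P.policy i (closedLoop P.f (P.policy i) P.noise P.x0 t))

/-- `i` is a best stabilizing controller: a minimizer of the total cost over `𝒮`. -/
def IsBestStabilizing (P : ControlProblem n m g N) (κ : ModelConstants) (T : ℕ)
    (i : Fin N) : Prop :=
  i ∈ P.stabilizing κ ∧ ∀ j ∈ P.stabilizing κ, P.fixedCost T i ≤ P.fixedCost T j

/-- The state `x_{t_b + j}` if controller `k` is used from the start `t_b` of the batch on. -/
def batchTraj (P : ControlProblem n m g N) (s : BatchState n N) (k : Fin N) (j : ℕ) :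
    EuclideanSpace ℝ (Fin n) :=
  closedLoop P.f (P.policy k) (fun i => P.noise (s.time + i)) s.x j

/-- The stability test fails on `x_{t+1}`, where `t = t_b + j`. -/
def violates (P : ControlProblem n m g N) (κ : ModelConstants) (s : BatchState n N)
    (k : Fin N) (j : ℕ) : Prop :=
  κ.β (j + 1) * ‖s.x‖ + κ.γ * κ.wMax < ‖P.batchTraj s k (j + 1)‖

/-- The Break statement is activated at some `t ∈ {t_b, …, min(t_b + τ_b - 1, T)}`; here `len`
is `τ_b`. -/
def breaks (P : ControlProblem n m g N) (κ : ModelConstants) (T len : ℕ) (s : BatchState n N)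
    (k : Fin N) : Prop :=
  ∃ j, j < min len (T + 1 - s.time) ∧ P.violates κ s k j

open Classical in
/-- The realized length `t_{b+1} - t_b` of the batch.  It is `0` once `t_b = T + 1`. -/
def batchLength (P : ControlProblem n m g N) (κ : ModelConstants) (T len : ℕ)
    (s : BatchState n N) (k : Fin N) : ℕ :=
  if h : P.breaks κ T len s k then Nat.find h + 1 else min len (T + 1 - s.time)

/-- The cost `w_b(k) = ∑_{t=t_b}^{t_{b+1}-1} c_t(x_t, u_t)` of the batch. -/
def batchCost (P : ControlProblem n m g N) (κ : ModelConstants) (T len : ℕ)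
    (s : BatchState n N) (k : Fin N) : ℝ :=
  ∑ j ∈ Finset.range (P.batchLength κ T len s k),
    P.cost (s.time + j) (P.batchTraj s k j) (P.policy k (P.batchTraj s k j))

end ControlProblem

/-- The probability `p_b(k)` of selecting controller `k`, with learning rate `η`. -/
def BatchState.prob {n N : ℕ} (η : ℝ) (s : BatchState n N) (k : Fin N) : ℝ :=
  if k ∈ s.pool then Real.exp (-η * s.W k) / ∑ i ∈ s.pool, Real.exp (-η * s.W i) else 0

namespace ControlProblem

variable {n m g N : ℕ}

open Classical in
/-- One batch of Dynamic Batching with selected controller `k`: run the controller, falsify it if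
the Break statement is activated, and add the importance-weighted cost `w_b(k) / p_b(k)` to its
weight.  (As `s_b = 0` for all `b`, weights are never reset and `η_b = η_0 = η`.) -/
def batchStep (P : ControlProblem n m g N) (κ : ModelConstants) (T len : ℕ) (η : ℝ)
    (s : BatchState n N) (k : Fin N) : BatchState n N where
  time := s.time + P.batchLength κ T len s k
  x := P.batchTraj s k (P.batchLength κ T len s k)
  pool := if P.breaks κ T len s k then s.pool.erase k else s.pool
  W := Function.update s.W k (s.W k + P.batchCost κ T len s k / s.prob η k)

/-- The state of the algorithm at the beginning of batch `b` if the selected controllers are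
`K 0, K 1, …`; `τ b` is the prescribed length of batch `b`. -/
def runState (P : ControlProblem n m g N) (κ : ModelConstants) (T : ℕ) (τ : ℕ → ℕ) (η : ℝ)
    (K : ℕ → Fin N) : ℕ → BatchState n N
  | 0 => { time := 0, x := P.x0, pool := Finset.univ, W := fun _ => 0 }
  | b + 1 => P.batchStep κ T (τ b) η (P.runState κ T τ η K b) (K b)

/-- The total cost `∑_{t=0}^T c_t(x_t, u_t)` along the selections `K`, summed batch by batch.
There are at most `T + 1` nonempty batches if all `τ b` are positive. -/
def runCost (P : ControlProblem n m g N) (κ : ModelConstants) (T : ℕ) (τ : ℕ → ℕ) (η : ℝ)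
    (K : ℕ → Fin N) : ℝ :=
  ∑ b ∈ Finset.range (T + 1), P.batchCost κ T (τ b) (P.runState κ T τ η K b) (K b)

/-- The probability that the algorithm makes the selections `K 0, …, K T`. -/
def runProb (P : ControlProblem n m g N) (κ : ModelConstants) (T : ℕ) (τ : ℕ → ℕ) (η : ℝ)
    (K : ℕ → Fin N) : ℝ :=
  ∏ b ∈ Finset.range (T + 1), (P.runState κ T τ η K b).prob η (K b)

/-- The regret `𝔼_K ∑_{t=0}^T [c_t(x_t, u_t) - c_t(x_t^*, u_t^*)]` of Dynamic Batching against the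
controller `istar`.  The expectation is the finite sum over all selections `(K 0, …, K T)`. -/
def regret (P : ControlProblem n m g N) (κ : ModelConstants) (T : ℕ) (τ : ℕ → ℕ) (η : ℝ)
    (istar : Fin N) : ℝ :=
  ∑ K : Fin (T + 1) → Fin N,
    P.runProb κ T τ η (fun b => K (Fin.ofNat (T + 1) b)) *
      (P.runCost κ T τ η (fun b => K (Fin.ofNat (T + 1) b)) - P.fixedCost T istar)

end ControlProblem

/-- The batch lengths `τ_0 = ⌊(z / M)^{1/2}⌋`, `τ_b = ⌈((ν b + z) / M)^{1/2}⌉` for `b ≥ 1`. -/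
def polyBatch (ν z M : ℝ) : ℕ → ℕ
  | 0 => ⌊Real.sqrt (z / M)⌋₊
  | b + 1 => ⌈Real.sqrt ((ν * ((b + 1 : ℕ) : ℝ) + z) / M)⌉₊

namespace ControlProblem

variable {n m g N : ℕ}

/-- `N (|𝒰| + 1)`. -/
def poolFactor (P : ControlProblem n m g N) (κ : ModelConstants) : ℝ :=
  (N : ℝ) * (((P.destabilizing κ).card : ℝ) + 1)

/-- The batch lengths of the algorithm, tuned with the known number `|𝒰|`. -/
def tunedBatch (P : ControlProblem n m g N) (κ : ModelConstants) (ν z : ℝ) : ℕ → ℕ :=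
  polyBatch ν z (P.poolFactor κ)

/-- The order `(|𝒰| + 1)^{2/3} / (T^{2/3} N^{1/3})` of the learning rate. -/
def rateScale (P : ControlProblem n m g N) (κ : ModelConstants) (T : ℕ) : ℝ :=
  (((P.destabilizing κ).card : ℝ) + 1) ^ (2 / 3 : ℝ) /
    ((T : ℝ) ^ (2 / 3 : ℝ) * (N : ℝ) ^ (1 / 3 : ℝ))

/-- The conditions on problem, horizon and tuning under which the regret bound is claimed. -/
structure Tuned (P : ControlProblem n m g N) (κ : ModelConstants) (ν ζ a₁ a₂ : ℝ) (T : ℕ)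
    (z η : ℝ) (istar : Fin N) : Prop where
  admissible : P.Admissible κ
  best : P.IsBestStabilizing κ T istar
  z_pos : 0 < z
  z_le : z ≤ ζ * P.poolFactor κ
  tau_pos : 0 < P.tunedBatch κ ν z 0
  tau_ratio : (P.tunedBatch κ ν z 1 : ℝ) / (P.tunedBatch κ ν z 0 : ℝ) *
    κ.β (P.tunedBatch κ ν z 0) ^ 2 < 1 / (2 * Real.sqrt 2)
  rate_ge : a₁ * P.rateScale κ T ≤ η
  rate_le : η ≤ a₂ * P.rateScale κ T
  horizon : max (((P.destabilizing κ).card : ℝ) ^ (3 / 2 : ℝ) / Real.sqrt (P.poolFactor κ))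
    (P.poolFactor κ) ≤ (T : ℝ)

end ControlProblem

end

open Filter Asymptotics

noncomputable section

/-! ### Adaptive random selections -/

/-! Dynamic Batching is exponential weights whose rounds are batches. The loss of an arm in a batch
is the cost it would incur if run from the state that the algorithm has actually reached. For the
potential `log (∑ exp (-η W_j)) / η + W_i` one importance-weighted update costs, in conditional
expectation, a second-order term `η / 2 * ∑ w_j ^ 2` (`expWeights_potential_step`). A stabilizing
comparator `i` is never falsified, so dropping arms only lowers the potential, which stays
nonnegative. By `regret_le_of_forall_path` the regret is thus at most `log N / η` plus a
deterministic bound on paths of positive probability: counterfactual batch costs of the comparator,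
minus its true cost, plus the second-order terms.

On such a path every falsification removes an element of `𝒰`, so there are at most `u = |𝒰|` of
them. A batch without falsification contracts the excess of the state over a fixed level by `3/4`; a
falsification expands it at most affinely. Hence the fourth powers of the excesses sum to at most
`jumpBase ^ u` (`sum_excess_pow_four_le`), the source of `exp (O(u))`. The stability test controls
all states that are charged in a batch, so any arm costs `O(D + H(D) ‖x‖²)` in a batch of full
length `D` started at `x`. For the comparator, incremental stability sharpens this to the benchmark
cost on the same time window plus `O(H(D) (1 + ‖x‖²))`. The windows of unbroken batches are
disjoint; broken batches are bounded crudely. This is `path_cost_le`.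

Let `M = N (u + 1)` and `X = (T² M)^{1/3}`, the claimed order. Lengths growing like `√(b / M)` give
`O(X)` batches of length at most `Θ = O(√(X / M))`, while `η N X` is of order `M`; so `log N / η`,
`u Θ` and `η N X Θ²` are all `X` up to logarithms. If `H(D) ≤ lam + rho * D`, then `∑ H(D_b)` is
`O(X lam + rho T)`. Cutting off at `log T` gives `rho → 0`, hence the `o(T)` term; a harmonic bound
on `H` allows `rho = 0`. The excess terms carry the factor `H(O(T^{1/3}))`, which is `o(T^{1/3})`
because Cesàro means of `β` vanish. -/

/-- A finite sequence of selections, continued by a default value. -/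
def extendSelection {ι : Type*} (k₀ : ι) (m : ℕ) (K : Fin m → ι) (b : ℕ) : ι :=
  if h : b < m then K ⟨b, h⟩ else k₀

theorem extendSelection_snoc_of_lt {ι : Type*} (k₀ k : ι) {m : ℕ} (K : Fin m → ι) {b : ℕ}
    (hb : b < m) :
    extendSelection k₀ (m + 1) (Fin.snoc (α := fun _ => ι) K k) b = extendSelection k₀ m K b := by
  have h1 : b < m + 1 := by omega
  have : (⟨b, h1⟩ : Fin (m + 1)) = Fin.castSucc ⟨b, hb⟩ := rfl
  simp only [extendSelection, h1, hb, dif_pos]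
  rw [this, Fin.snoc_castSucc]

theorem extendSelection_snoc_self {ι : Type*} (k₀ k : ι) {m : ℕ} (K : Fin m → ι) :
    extendSelection k₀ (m + 1) (Fin.snoc (α := fun _ => ι) K k) m = k := by
  have h1 : m < m + 1 := by omega
  have : (⟨m, h1⟩ : Fin (m + 1)) = Fin.last m := rfl
  simp only [extendSelection, h1, dif_pos]
  rw [this, Fin.snoc_last]

theorem congr_of_adapted {S ι : Type*} {step : ℕ → S → ι → S} {run : (ℕ → ι) → ℕ → S} {s₀ : S}
    (h0 : ∀ K, run K 0 = s₀) (hs : ∀ K b, run K (b + 1) = step b (run K b) (K b))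
    {K K' : ℕ → ι} {m : ℕ} (h : ∀ b < m, K b = K' b) : run K m = run K' m := by
  induction m with
  | zero => rw [h0, h0]
  | succ m ih => rw [hs, hs, ih fun b hb => h b (by omega), h m (by omega)]

/-- If the potential `ψ` dominates, in conditional expectation, the next loss plus the next
potential, then the expected total loss plus the final potential is at most the initial one. -/
theorem expectation_add_potential_le {S ι : Type*} [Fintype ι] (k₀ : ι)
    (step : ℕ → S → ι → S) (run : (ℕ → ι) → ℕ → S) (s₀ : S)
    (h0 : ∀ K, run K 0 = s₀) (hs : ∀ K b, run K (b + 1) = step b (run K b) (K b))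
    (p : S → ι → ℝ) (ℓ : ℕ → S → ι → ℝ) (ψ : S → ℝ) (I : S → Prop)
    (hI0 : I s₀) (hI : ∀ b s k, I s → I (step b s k))
    (hp : ∀ s k, 0 ≤ p s k) (hp1 : ∀ s, I s → ∑ k, p s k = 1)
    (hstep : ∀ b s, I s → ∑ k, p s k * (ℓ b s k + ψ (step b s k)) ≤ ψ s) (m : ℕ) :
    ∑ K : Fin m → ι,
      (∏ b ∈ Finset.range m, p (run (extendSelection k₀ m K) b) (extendSelection k₀ m K b)) *
        (∑ b ∈ Finset.range m,
            ℓ b (run (extendSelection k₀ m K) b) (extendSelection k₀ m K b) +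
          ψ (run (extendSelection k₀ m K) m)) ≤ ψ s₀ := by
  have hIrun : ∀ K b, I (run K b) := by
    intro K b
    induction b with
    | zero => rw [h0]; exact hI0
    | succ b ih => rw [hs]; exact hI _ _ _ ih
  induction m with
  | zero => simp [h0]
  | succ m ih =>
    refine le_trans ?_ ih
    -- Split off the last selection. With the earlier ones fixed, the state at `m` is fixed too, and
    -- the inner sum is the conditional expectation to which `hstep` applies.
    rw [← (Fin.snocEquiv fun _ : Fin (m + 1) => ι).sum_comp, Fintype.sum_prod_type_right]
    refine Finset.sum_le_sum fun K _ => ?_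
    set E := extendSelection k₀ m K with hE
    have key : ∀ k : ι,
        (∏ b ∈ Finset.range (m + 1),
          p (run (extendSelection k₀ (m + 1) (Fin.snoc (α := fun _ => ι) K k)) b)
            (extendSelection k₀ (m + 1) (Fin.snoc (α := fun _ => ι) K k) b)) *
        (∑ b ∈ Finset.range (m + 1),
            ℓ b (run (extendSelection k₀ (m + 1) (Fin.snoc (α := fun _ => ι) K k)) b)
              (extendSelection k₀ (m + 1) (Fin.snoc (α := fun _ => ι) K k) b) +
          ψ (run (extendSelection k₀ (m + 1) (Fin.snoc (α := fun _ => ι) K k)) (m + 1))) =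
        (∏ b ∈ Finset.range m, p (run E b) (E b)) *
          (p (run E m) k * (∑ b ∈ Finset.range m, ℓ b (run E b) (E b)) +
            p (run E m) k * (ℓ m (run E m) k + ψ (step m (run E m) k))) := by
      intro k
      set F := extendSelection k₀ (m + 1) (Fin.snoc (α := fun _ => ι) K k) with hF
      have hFE : ∀ b < m, F b = E b := fun b hb => extendSelection_snoc_of_lt k₀ k K hb
      have hFm : F m = k := extendSelection_snoc_self k₀ k K
      have hrun : ∀ b ≤ m, run F b = run E b := fun b hb =>
        congr_of_adapted h0 hs fun a ha => hFE a (by omega)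
      rw [Finset.prod_range_succ, Finset.sum_range_succ, hs, hrun m le_rfl, hFm,
        Finset.prod_congr rfl fun b hb => by
          rw [hrun b (Finset.mem_range.1 hb).le, hFE b (Finset.mem_range.1 hb)],
        Finset.sum_congr rfl fun b hb => by
          rw [hrun b (Finset.mem_range.1 hb).le, hFE b (Finset.mem_range.1 hb)]]
      ring
    calc _ = ∑ k, (∏ b ∈ Finset.range m, p (run E b) (E b)) *
          (p (run E m) k * (∑ b ∈ Finset.range m, ℓ b (run E b) (E b)) +
            p (run E m) k * (ℓ m (run E m) k + ψ (step m (run E m) k))) :=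
          Finset.sum_congr rfl fun k _ => key k
      _ ≤ _ := by
        rw [← Finset.mul_sum, Finset.sum_add_distrib, ← Finset.sum_mul, hp1 _ (hIrun _ _), one_mul]
        refine mul_le_mul_of_nonneg_left ?_ (Finset.prod_nonneg fun b _ => hp _ _)
        linarith [hstep m _ (hIrun E m)]

/-! ### Exponential weights -/

/-- Follows from `1 + x + x²/2 ≤ exp x`, since `(1 - x + x²/2) (1 + x + x²/2) = 1 + x⁴/4 ≥ 1`. -/
theorem exp_neg_le_quadratic {x : ℝ} (hx : 0 ≤ x) : Real.exp (-x) ≤ 1 - x + x ^ 2 / 2 := by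
  have h := Real.quadratic_le_exp_of_nonneg hx
  have hpos : (0 : ℝ) < 1 + x + x ^ 2 / 2 := by positivity
  have h2 : Real.exp (-x) * Real.exp x = 1 := by rw [← Real.exp_add]; simp
  have h3 : Real.exp (-x) * (1 + x + x ^ 2 / 2) ≤ 1 :=
    (mul_le_mul_of_nonneg_left h (Real.exp_pos _).le).trans_eq h2
  by_contra hc
  push Not at hc
  have h4 := mul_lt_mul_of_pos_right hc hpos
  nlinarith [sq_nonneg (x ^ 2)]

/-- One step of exponential weights with importance-weighted losses `w k / p k`, where moreover
arms may be dropped from the pool. -/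
theorem expWeights_potential_step {ι : Type*} [Fintype ι] [DecidableEq ι] {η : ℝ} (hη : 0 < η)
    (pool : Finset ι) (W p w : ι → ℝ) (hw : ∀ k, 0 ≤ w k) {i : ι} (hi : i ∈ pool)
    (hp : ∀ k, p k = if k ∈ pool then
      Real.exp (-η * W k) / ∑ j ∈ pool, Real.exp (-η * W j) else 0)
    (pool' : ι → Finset ι) (hsub : ∀ k, pool' k ⊆ pool) (hi' : ∀ k, i ∈ pool' k)
    (W' : ι → ι → ℝ) (hW' : ∀ k, W' k = Function.update (W) k (W k + w k / p k)) :
    ∑ k, p k * ((w k - w i - η / 2 * ∑ j ∈ pool, w j ^ 2) +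
        (Real.log (∑ j ∈ pool' k, Real.exp (-η * W' k j)) / η + W' k i)) ≤
      Real.log (∑ j ∈ pool, Real.exp (-η * W j)) / η + W i := by
  set Φ := ∑ j ∈ pool, Real.exp (-η * W j) with hΦ
  have hΦpos : 0 < Φ := Finset.sum_pos (fun j _ => Real.exp_pos _) ⟨i, hi⟩
  have hppos : ∀ k ∈ pool, 0 < p k := fun k hk => by
    rw [hp, if_pos hk]; exact div_pos (Real.exp_pos _) hΦpos
  have hpz : ∀ k, k ∉ pool → p k = 0 := fun k hk => by rw [hp, if_neg hk]
  have hsum : ∑ k ∈ pool, p k = 1 := by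
    rw [Finset.sum_congr rfl fun k hk => by rw [hp, if_pos hk], ← Finset.sum_div, ← hΦ,
      div_self hΦpos.ne']
  have hres : ∀ F : ι → ℝ, ∑ k, p k * F k = ∑ k ∈ pool, p k * F k := fun F =>
    (Finset.sum_subset (Finset.subset_univ _) fun k _ hk => by rw [hpz k hk, zero_mul]).symm
  rw [hres]
  have hlog : ∀ k ∈ pool, Real.log (∑ j ∈ pool' k, Real.exp (-η * W' k j)) ≤
      Real.log Φ + (-η * w k + η ^ 2 * w k ^ 2 / (2 * p k)) := by
    intro k hk
    have hpk := hppos k hk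
    have h1 : ∑ j ∈ pool' k, Real.exp (-η * W' k j) ≤ ∑ j ∈ pool, Real.exp (-η * W' k j) :=
      Finset.sum_le_sum_of_subset_of_nonneg (hsub k) fun _ _ _ => (Real.exp_pos _).le
    have h2 : ∑ j ∈ pool, Real.exp (-η * W' k j) =
        Φ - Real.exp (-η * W k) + Real.exp (-η * (W k + w k / p k)) := by
      rw [hΦ, ← Finset.add_sum_erase _ _ hk, ← Finset.add_sum_erase pool _ hk, hW']
      have : ∑ x ∈ pool.erase k,
          Real.exp (-η * Function.update W k (W k + w k / p k) x) =
          ∑ x ∈ pool.erase k, Real.exp (-η * W x) :=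
        Finset.sum_congr rfl fun j hj => by
          rw [Function.update_of_ne (Finset.ne_of_mem_erase hj)]
      rw [this, Function.update_self]
      ring
    have h3 : Real.exp (-η * W k) = p k * Φ := by
      rw [hp k, if_pos hk]; field_simp
    have h4 : Real.exp (-η * (W k + w k / p k)) ≤
        p k * Φ * (1 - η * w k / p k + (η * w k / p k) ^ 2 / 2) := by
      have : -η * (W k + w k / p k) = -η * W k + -(η * w k / p k) := by ring
      rw [this, Real.exp_add, h3]
      refine mul_le_mul_of_nonneg_left (exp_neg_le_quadratic ?_)
        (mul_pos hpk hΦpos).le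
      exact div_nonneg (mul_nonneg hη.le (hw k)) hpk.le
    have h5 : ∑ j ∈ pool' k, Real.exp (-η * W' k j) ≤
        Φ * (1 + (-η * w k + η ^ 2 * w k ^ 2 / (2 * p k))) := by
      refine (h1.trans_eq h2).trans ?_
      rw [h3]
      refine (add_le_add_right h4 _).trans_eq ?_
      field_simp
      ring
    have h6 : 1 + (-η * w k + η ^ 2 * w k ^ 2 / (2 * p k)) ≤
        Real.exp (-η * w k + η ^ 2 * w k ^ 2 / (2 * p k)) := by
      linarith [Real.add_one_le_exp (-η * w k + η ^ 2 * w k ^ 2 / (2 * p k))]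
    have hpos : 0 < ∑ j ∈ pool' k, Real.exp (-η * W' k j) :=
      Finset.sum_pos (fun j _ => Real.exp_pos _) ⟨i, hi' k⟩
    calc _ ≤ Real.log (Φ * Real.exp (-η * w k + η ^ 2 * w k ^ 2 / (2 * p k))) :=
          Real.log_le_log hpos (h5.trans (mul_le_mul_of_nonneg_left h6 hΦpos.le))
      _ = _ := by rw [Real.log_mul hΦpos.ne' (Real.exp_pos _).ne', Real.log_exp]
  -- Importance weighting is unbiased: the factor `p k` cancels, so the expected increase of the
  -- weight of `i` is its true loss.
  have hWi : ∀ k ∈ pool, p k * W' k i = p k * W i + if k = i then w i else 0 := by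
    intro k hk
    have hpk := hppos k hk
    rw [hW']
    by_cases hki : k = i
    · subst hki
      rw [Function.update_self, if_pos rfl]
      field_simp
    · rw [Function.update_of_ne (Ne.symm hki), if_neg hki, add_zero]
  have hterm : ∀ k ∈ pool, p k * ((w k - w i - η / 2 * ∑ j ∈ pool, w j ^ 2) +
        (Real.log (∑ j ∈ pool' k, Real.exp (-η * W' k j)) / η + W' k i)) ≤
      p k * (Real.log Φ / η + W i - w i - η / 2 * ∑ j ∈ pool, w j ^ 2) +
        η / 2 * w k ^ 2 + if k = i then w i else 0 := by
    intro k hk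
    have hpk := hppos k hk
    have h1 : Real.log (∑ j ∈ pool' k, Real.exp (-η * W' k j)) / η ≤
        Real.log Φ / η + (-w k + η * w k ^ 2 / (2 * p k)) := by
      rw [div_le_iff₀ hη]
      refine (hlog k hk).trans_eq ?_
      field_simp
    have h2 := mul_le_mul_of_nonneg_left h1 hpk.le
    have h3 : p k * (Real.log Φ / η + (-w k + η * w k ^ 2 / (2 * p k))) =
        p k * (Real.log Φ / η) - p k * w k + η / 2 * w k ^ 2 := by
      field_simp
      ring
    have h4 := hWi k hk
    nlinarith
  refine (Finset.sum_le_sum hterm).trans_eq ?_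
  rw [Finset.sum_add_distrib, Finset.sum_add_distrib, ← Finset.sum_mul, hsum,
    Finset.sum_ite_eq', if_pos hi, ← Finset.mul_sum]
  ring

/-! ### Elementary facts on the gains -/

namespace ModelConstants

variable (κ : ModelConstants)

theorem β_nonneg (t : ℕ) : 0 ≤ κ.β t := κ.β_antitone.le_of_tendsto κ.β_tendsto t

theorem β_le_one (t : ℕ) : κ.β t ≤ 1 := κ.β_zero ▸ κ.β_antitone (Nat.zero_le t)

theorem H_zero : κ.H 0 = 0 := by simp [H]

theorem H_nonneg (t : ℕ) : 0 ≤ κ.H t := Finset.sum_nonneg fun i _ => κ.β_nonneg i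

theorem H_mono : Monotone κ.H := fun a b hab =>
  Finset.sum_le_sum_of_subset_of_nonneg (by simpa using hab) fun i _ _ => κ.β_nonneg i

theorem H_le (t : ℕ) : κ.H t ≤ t := by
  calc κ.H t ≤ ∑ _i ∈ Finset.range t, (1 : ℝ) := Finset.sum_le_sum fun i _ => κ.β_le_one i
    _ = t := by simp

/-- The first `L` summands are at most `1`, all later ones at most `β L`. The free cut-off `L` is
later chosen to grow with the horizon. -/
theorem H_le_add_mul (L t : ℕ) : κ.H t ≤ L + t * κ.β L := by
  have h : ∀ i ∈ Finset.range t, κ.β i ≤ (if i < L then 1 else 0) + κ.β L := by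
    intro i _
    split_ifs with hi
    · linarith [κ.β_le_one i, κ.β_nonneg L]
    · linarith [κ.β_antitone (not_lt.1 hi)]
  refine (Finset.sum_le_sum h).trans ?_
  rw [Finset.sum_add_distrib, Finset.sum_const, Finset.card_range, nsmul_eq_mul]
  gcongr
  rw [← Finset.sum_filter, Finset.sum_const, nsmul_eq_mul, mul_one]
  have : (Finset.range t).filter (· < L) ⊆ Finset.range L := fun i hi => by
    simpa using (Finset.mem_filter.1 hi).2
  exact_mod_cast (Finset.card_le_card this).trans_eq (Finset.card_range L)

theorem γw_pos : 0 < κ.γ * κ.wMax := mul_pos κ.γ_pos κ.wMax_pos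

end ModelConstants

theorem closedLoop_add {n m g : ℕ}
    (f : EuclideanSpace ℝ (Fin n) → EuclideanSpace ℝ (Fin m) → EuclideanSpace ℝ (Fin g) →
      EuclideanSpace ℝ (Fin n))
    (π : EuclideanSpace ℝ (Fin n) → EuclideanSpace ℝ (Fin m))
    (w : ℕ → EuclideanSpace ℝ (Fin g)) (x : EuclideanSpace ℝ (Fin n)) (s j : ℕ) :
    closedLoop f π (fun i => w (s + i)) (closedLoop f π w x s) j = closedLoop f π w x (s + j) := by
  induction j with
  | zero => rfl
  | succ j ih => rw [closedLoop, ih]; rfl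

/-! ### Growth and Lipschitz bounds for costs and dynamics under a controller -/

namespace ControlProblem

/-- The constant of the quadratic growth bound for the cost of a controller. -/
def growthConst (κ : ModelConstants) : ℝ :=
  κ.c0Max + (κ.Lc1 + κ.Lc2) * (2 * (1 + |κ.Lπ|) ^ 2 + 2 * κ.π0Max ^ 2 + 1)

/-- The constant of the local Lipschitz bound for the cost of a controller. -/
def lipConst (κ : ModelConstants) : ℝ :=
  (κ.Lc1 * (1 + |κ.Lπ| + κ.π0Max) + κ.Lc2) * (1 + |κ.Lπ|)

theorem growthConst_nonneg (κ : ModelConstants) : 0 ≤ growthConst κ := by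
  have := κ.c0Max_nonneg
  have := κ.Lc1_pos
  have := κ.Lc2_pos
  unfold growthConst
  positivity

theorem lipConst_nonneg (κ : ModelConstants) : 0 ≤ lipConst κ := by
  have := κ.π0Max_nonneg
  have := κ.Lc1_pos
  have := κ.Lc2_pos
  unfold lipConst
  positivity

variable {n m g N : ℕ} {P : ControlProblem n m g N} {κ : ModelConstants}

namespace Admissible

theorem norm_policy_sub_le (hP : P.Admissible κ) (i : Fin N) (x x' : EuclideanSpace ℝ (Fin n)) :
    ‖P.policy i x - P.policy i x'‖ ≤ |κ.Lπ| * ‖x - x'‖ :=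
  (hP.policy_lipschitz i x x').trans
    (mul_le_mul_of_nonneg_right (le_abs_self _) (norm_nonneg _))

theorem norm_policy_le (hP : P.Admissible κ) (i : Fin N) (x : EuclideanSpace ℝ (Fin n)) :
    ‖P.policy i x‖ ≤ |κ.Lπ| * ‖x‖ + κ.π0Max := by
  have h := hP.norm_policy_sub_le i x 0
  rw [sub_zero] at h
  have h2 := norm_sub_norm_le (P.policy i x) (P.policy i 0)
  linarith [hP.policy_zero i]

theorem cost_policy_le (hP : P.Admissible κ) (t : ℕ) (i : Fin N) (x : EuclideanSpace ℝ (Fin n)) :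
    P.cost t x (P.policy i x) ≤ growthConst κ * (1 + ‖x‖ ^ 2) := by
  have h := (abs_le.1 (hP.cost_lipschitz t x 0 (P.policy i x) 0)).2
  rw [sub_zero, sub_zero, norm_zero, norm_zero, max_eq_left (norm_nonneg _),
    max_eq_left (norm_nonneg _)] at h
  have h0 := (abs_le.1 (hP.cost_zero t)).2
  have hu := hP.norm_policy_le i x
  set r := ‖x‖ with hr
  set a := r + ‖P.policy i x‖ with ha
  have hr0 : 0 ≤ r := norm_nonneg _
  have ha0 : 0 ≤ a := add_nonneg hr0 (norm_nonneg _)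
  have hπ := κ.π0Max_nonneg
  have h1 := κ.Lc1_pos
  have h2 := κ.Lc2_pos
  have hc := κ.c0Max_nonneg
  set l := 1 + |κ.Lπ| with hl
  have hl0 : 0 ≤ l := by positivity
  have hal : a ≤ l * r + κ.π0Max := by rw [hl]; linarith
  have ha2 : a ^ 2 ≤ 2 * l ^ 2 * r ^ 2 + 2 * κ.π0Max ^ 2 := by
    have : a ^ 2 ≤ (l * r + κ.π0Max) ^ 2 := by gcongr
    nlinarith [sq_nonneg (l * r - κ.π0Max)]
  have h3 : (κ.Lc1 * a + κ.Lc2) * a ≤ (κ.Lc1 + κ.Lc2) * (a ^ 2 + 1) := by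
    nlinarith [mul_nonneg h2.le (sq_nonneg (a - 1)), mul_nonneg h2.le ha0,
      mul_nonneg h2.le (sq_nonneg a)]
  have h4 : a ^ 2 + 1 ≤ (2 * l ^ 2 + 2 * κ.π0Max ^ 2 + 1) * (1 + r ^ 2) := by
    have : 0 ≤ κ.π0Max ^ 2 * r ^ 2 := by positivity
    nlinarith [sq_nonneg l, sq_nonneg r]
  have h5 := mul_le_mul_of_nonneg_left h4 (add_nonneg h1.le h2.le)
  have h6 : κ.c0Max ≤ κ.c0Max * (1 + r ^ 2) := by nlinarith [sq_nonneg r]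
  unfold growthConst
  rw [← hl]
  nlinarith

theorem cost_policy_sub_le (hP : P.Admissible κ) (t : ℕ) (i : Fin N)
    (x x' : EuclideanSpace ℝ (Fin n)) :
    P.cost t x (P.policy i x) - P.cost t x' (P.policy i x') ≤
      lipConst κ * (1 + ‖x‖ + ‖x'‖) * ‖x - x'‖ := by
  refine ((abs_le.1 (hP.cost_lipschitz t x x' (P.policy i x) (P.policy i x'))).2).trans ?_
  have h1 := κ.Lc1_pos
  have h2 := κ.Lc2_pos
  have hπ := κ.π0Max_nonneg
  have hx := norm_nonneg x
  have hx' := norm_nonneg x'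
  have hL := abs_nonneg κ.Lπ
  have hm1 : max ‖x‖ ‖x'‖ ≤ ‖x‖ + ‖x'‖ := max_le (by linarith) (by linarith)
  have hm2 : max ‖P.policy i x‖ ‖P.policy i x'‖ ≤ |κ.Lπ| * (‖x‖ + ‖x'‖) + κ.π0Max := by
    refine max_le ?_ ?_
    · nlinarith [hP.norm_policy_le i x, mul_nonneg hL hx']
    · nlinarith [hP.norm_policy_le i x', mul_nonneg hL hx]
  have hA : κ.Lc1 * (max ‖x‖ ‖x'‖ + max ‖P.policy i x‖ ‖P.policy i x'‖) + κ.Lc2 ≤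
      (κ.Lc1 * (1 + |κ.Lπ| + κ.π0Max) + κ.Lc2) * (1 + ‖x‖ + ‖x'‖) := by
    have : max ‖x‖ ‖x'‖ + max ‖P.policy i x‖ ‖P.policy i x'‖ ≤
        (1 + |κ.Lπ| + κ.π0Max) * (1 + ‖x‖ + ‖x'‖) := by
      nlinarith [mul_nonneg hπ hx, mul_nonneg hπ hx']
    have h3 := mul_le_mul_of_nonneg_left this h1.le
    nlinarith
  have hB : ‖x - x'‖ + ‖P.policy i x - P.policy i x'‖ ≤ (1 + |κ.Lπ|) * ‖x - x'‖ := by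
    linarith [hP.norm_policy_sub_le i x x']
  calc _ ≤ ((κ.Lc1 * (1 + |κ.Lπ| + κ.π0Max) + κ.Lc2) * (1 + ‖x‖ + ‖x'‖)) *
        ((1 + |κ.Lπ|) * ‖x - x'‖) := by
        refine mul_le_mul hA hB (by positivity) (by positivity)
    _ = _ := by unfold lipConst; ring

/-- One step of any controller, stable or not; this limits the damage done by the single step on
which the stability test fails. -/
theorem norm_f_policy_le (hP : P.Admissible κ) (i : Fin N) (x : EuclideanSpace ℝ (Fin n))
    {w : EuclideanSpace ℝ (Fin g)} (hw : ‖w‖ ≤ κ.wMax) :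
    ‖P.f x (P.policy i x) w‖ ≤
      κ.Lf * (1 + |κ.Lπ|) * ‖x‖ + (κ.Lf * (κ.π0Max + κ.wMax) + |κ.f0|) := by
  have h := hP.f_lipschitz x 0 (P.policy i x) 0 w 0 hw (by simpa using κ.wMax_pos.le)
  rw [sub_zero, sub_zero, sub_zero] at h
  have h2 := norm_sub_norm_le (P.f x (P.policy i x) w) (P.f 0 0 0)
  have h3 := hP.f_zero.trans (le_abs_self _)
  have h4 : ‖x‖ + ‖P.policy i x‖ + ‖w‖ ≤ (1 + |κ.Lπ|) * ‖x‖ + (κ.π0Max + κ.wMax) := by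
    linarith [hP.norm_policy_le i x]
  have h5 := mul_le_mul_of_nonneg_left h4 (zero_le_one.trans κ.one_le_Lf)
  linarith

end Admissible

/-! ### A single batch -/

variable {T len : ℕ} {s : BatchState n N} {k : Fin N}

theorem batchLength_le : P.batchLength κ T len s k ≤ min len (T + 1 - s.time) := by
  classical
  unfold batchLength
  split_ifs with h
  · exact (Nat.find_spec h).1
  · exact le_rfl

theorem batchLength_of_not_breaks (h : ¬ P.breaks κ T len s k) :
    P.batchLength κ T len s k = min len (T + 1 - s.time) := by
  rw [batchLength, dif_neg h]

/-- A batch stops at its first failed test, so only its final state can be out of bounds. That state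
is not charged to the batch, which is why the strict inequality suffices for the costs. -/
theorem not_violates_of_lt_batchLength {j : ℕ} (hj : j + 1 < P.batchLength κ T len s k) :
    ¬ P.violates κ s k j := by
  classical
  intro hv
  by_cases h : P.breaks κ T len s k
  · rw [batchLength, dif_pos h] at hj
    refine Nat.find_min h (m := j) (by omega) ⟨?_, hv⟩
    have := (Nat.find_spec h).1
    omega
  · rw [batchLength_of_not_breaks h] at hj
    exact h ⟨j, by omega, hv⟩

theorem norm_batchTraj_le_of_lt {j : ℕ} (hj : j < P.batchLength κ T len s k) :
    ‖P.batchTraj s k j‖ ≤ κ.β j * ‖s.x‖ + κ.γ * κ.wMax := by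
  cases j with
  | zero =>
    rw [κ.β_zero, one_mul]
    have : P.batchTraj s k 0 = s.x := rfl
    rw [this]
    linarith [κ.γw_pos]
  | succ j => exact not_lt.1 (not_violates_of_lt_batchLength hj)

theorem norm_batchTraj_le_of_not_breaks (h : ¬ P.breaks κ T len s k) {j : ℕ}
    (hj : j ≤ min len (T + 1 - s.time)) :
    ‖P.batchTraj s k j‖ ≤ κ.β j * ‖s.x‖ + κ.γ * κ.wMax := by
  cases j with
  | zero =>
    rw [κ.β_zero, one_mul]
    have : P.batchTraj s k 0 = s.x := rfl
    rw [this]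
    linarith [κ.γw_pos]
  | succ j => exact not_lt.1 fun hv => h ⟨j, by omega, hv⟩

theorem not_breaks_of_isISS (hP : P.Admissible κ) (hk : IsISSController κ P.f (P.policy k)) :
    ¬ P.breaks κ T len s k := by
  rintro ⟨j, -, hv⟩
  exact absurd (hk s.x (fun i => P.noise (s.time + i)) (fun i => hP.noise_bound _) (j + 1))
    (not_le.2 hv)

theorem mem_destabilizing_of_breaks (hP : P.Admissible κ) (h : P.breaks κ T len s k) :
    k ∈ P.destabilizing κ := by
  classical
  rw [destabilizing, Finset.mem_filter]
  exact ⟨Finset.mem_univ _, fun hk => not_breaks_of_isISS hP hk h⟩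

theorem one_le_batchLength_of_breaks (h : P.breaks κ T len s k) :
    1 ≤ P.batchLength κ T len s k := by
  rw [batchLength, dif_pos h]
  omega

theorem norm_next_le_of_breaks (hP : P.Admissible κ) (h : P.breaks κ T len s k) :
    ‖P.batchTraj s k (P.batchLength κ T len s k)‖ ≤
      κ.Lf * (1 + |κ.Lπ|) * (‖s.x‖ + κ.γ * κ.wMax) + (κ.Lf * (κ.π0Max + κ.wMax) + |κ.f0|) := by
  obtain ⟨j, hj⟩ : ∃ j, P.batchLength κ T len s k = j + 1 :=
    ⟨_, (Nat.succ_pred_eq_of_pos (one_le_batchLength_of_breaks h)).symm⟩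
  have h1 := norm_batchTraj_le_of_lt (P := P) (κ := κ) (T := T) (len := len) (s := s) (k := k)
    (j := j) (by omega)
  rw [hj]
  refine (hP.norm_f_policy_le k (P.batchTraj s k j) (hP.noise_bound (s.time + j))).trans ?_
  have h2 : ‖P.batchTraj s k j‖ ≤ ‖s.x‖ + κ.γ * κ.wMax := by
    nlinarith [κ.β_le_one j, norm_nonneg s.x]
  have := κ.one_le_Lf
  gcongr

theorem batchCost_nonneg (hP : P.Admissible κ) : 0 ≤ P.batchCost κ T len s k :=
  Finset.sum_nonneg fun _ _ => hP.cost_nonneg _ _ _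

/-- Costs grow quadratically, and `β ^ 2 ≤ β` turns the sum of the squared stability bounds into
`H`. Stability of `k` plays no role: the test alone bounds the states. -/
theorem batchCost_le (hP : P.Admissible κ) :
    P.batchCost κ T len s k ≤ growthConst κ * (1 + 2 * (κ.γ * κ.wMax) ^ 2) *
        (min len (T + 1 - s.time) : ℕ) +
      2 * growthConst κ * ‖s.x‖ ^ 2 * κ.H (min len (T + 1 - s.time)) := by
  set D := min len (T + 1 - s.time)
  have hC := growthConst_nonneg κ
  have h1 : ∀ j ∈ Finset.range (P.batchLength κ T len s k),
      P.cost (s.time + j) (P.batchTraj s k j) (P.policy k (P.batchTraj s k j)) ≤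
        growthConst κ * (1 + 2 * (κ.γ * κ.wMax) ^ 2) + 2 * growthConst κ * ‖s.x‖ ^ 2 * κ.β j := by
    intro j hj
    refine (hP.cost_policy_le _ _ _).trans ?_
    have h2 := norm_batchTraj_le_of_lt (Finset.mem_range.1 hj)
    have h3 : ‖P.batchTraj s k j‖ ^ 2 ≤ (κ.β j * ‖s.x‖ + κ.γ * κ.wMax) ^ 2 := by gcongr
    have h4 : κ.β j ^ 2 * ‖s.x‖ ^ 2 ≤ κ.β j * ‖s.x‖ ^ 2 := by
      have := κ.β_nonneg j
      have := κ.β_le_one j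
      gcongr
      nlinarith
    have h5 : 1 + ‖P.batchTraj s k j‖ ^ 2 ≤
        1 + 2 * (κ.γ * κ.wMax) ^ 2 + 2 * (κ.β j * ‖s.x‖ ^ 2) := by
      nlinarith [sq_nonneg (κ.β j * ‖s.x‖ - κ.γ * κ.wMax)]
    refine (mul_le_mul_of_nonneg_left h5 hC).trans_eq ?_
    ring
  refine (Finset.sum_le_sum h1).trans ?_
  refine (Finset.sum_le_sum_of_subset_of_nonneg
    (Finset.range_subset_range.2 (batchLength_le (P := P) (κ := κ) (T := T) (len := len))) ?_).trans
    (b := ∑ j ∈ Finset.range D, (growthConst κ * (1 + 2 * (κ.γ * κ.wMax) ^ 2) +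
      2 * growthConst κ * ‖s.x‖ ^ 2 * κ.β j)) ?_
  · intro j _ _
    have := κ.β_nonneg j
    positivity
  · rw [Finset.sum_add_distrib, Finset.sum_const, Finset.card_range, nsmul_eq_mul,
      ← Finset.mul_sum, ModelConstants.H]
    linarith

/-- The state of the closed loop of an input-to-state stable controller, from `x0`. -/
theorem norm_closedLoop_le (hP : P.Admissible κ) (hk : IsISSController κ P.f (P.policy k))
    (t : ℕ) : ‖closedLoop P.f (P.policy k) P.noise P.x0 t‖ ≤ |κ.x0Max| + κ.γ * κ.wMax := by
  refine (hk P.x0 P.noise hP.noise_bound t).trans ?_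
  have h1 := hP.x0_bound.trans (le_abs_self _)
  nlinarith [κ.β_le_one t, κ.β_nonneg t, norm_nonneg P.x0]

/-- From the start of the batch on, the benchmark is the same closed loop with the same noise from
another state. Incremental stability makes the two trajectories merge at rate `β`, and the cost gap
sums to a multiple of `H`. -/
theorem batchCost_stabilizing_le (hP : P.Admissible κ) (hk : k ∈ P.stabilizing κ) :
    P.batchCost κ T len s k ≤
      ∑ j ∈ Finset.range (min len (T + 1 - s.time)),
        P.cost (s.time + j) (closedLoop P.f (P.policy k) P.noise P.x0 (s.time + j))
          (P.policy k (closedLoop P.f (P.policy k) P.noise P.x0 (s.time + j))) +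
      lipConst κ * (2 * (1 + 2 * (κ.γ * κ.wMax) + |κ.x0Max|) ^ 2 + 2 * ‖s.x‖ ^ 2) *
        κ.H (min len (T + 1 - s.time)) := by
  classical
  obtain ⟨-, hiss, hinc⟩ := Finset.mem_filter.1 hk
  have hnb : ¬ P.breaks κ T len s k := not_breaks_of_isISS hP hiss
  rw [batchCost, batchLength_of_not_breaks hnb, ModelConstants.H, Finset.mul_sum,
    ← Finset.sum_add_distrib]
  refine Finset.sum_le_sum fun j hj => ?_
  set X := closedLoop P.f (P.policy k) P.noise P.x0 with hX
  have h1 := hP.cost_policy_sub_le (s.time + j) k (P.batchTraj s k j) (X (s.time + j))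
  have h2 := norm_batchTraj_le_of_not_breaks hnb (Finset.mem_range.1 hj).le
  have h3 := norm_closedLoop_le hP hiss (s.time + j)
  have h3' := norm_closedLoop_le hP hiss s.time
  have h4 := hinc s.x (X s.time) (fun i => P.noise (s.time + i)) (fun i => hP.noise_bound _) j
  rw [hX, closedLoop_add, ← hX] at h4
  have h5 : ‖s.x - X s.time‖ ≤ ‖s.x‖ + (|κ.x0Max| + κ.γ * κ.wMax) :=
    (norm_sub_le _ _).trans (by linarith)
  have hb0 := κ.β_nonneg j
  have hb1 := κ.β_le_one j
  have hy := norm_nonneg s.x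
  have hγ := κ.γw_pos
  have hx0 := abs_nonneg κ.x0Max
  have hl := lipConst_nonneg κ
  have h6 : 1 + ‖P.batchTraj s k j‖ + ‖X (s.time + j)‖ ≤
      1 + 2 * (κ.γ * κ.wMax) + |κ.x0Max| + ‖s.x‖ := by nlinarith
  have h7 : ‖P.batchTraj s k j - X (s.time + j)‖ ≤
      κ.β j * (1 + 2 * (κ.γ * κ.wMax) + |κ.x0Max| + ‖s.x‖) := by
    refine h4.trans (mul_le_mul_of_nonneg_left ?_ hb0)
    linarith
  set G := 1 + 2 * (κ.γ * κ.wMax) + |κ.x0Max| with hG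
  have hG0 : 0 ≤ G := by positivity
  have h8 : (1 + ‖P.batchTraj s k j‖ + ‖X (s.time + j)‖) * ‖P.batchTraj s k j - X (s.time + j)‖ ≤
      (G + ‖s.x‖) * (κ.β j * (G + ‖s.x‖)) :=
    mul_le_mul h6 h7 (norm_nonneg _) (by positivity)
  have h9 : (G + ‖s.x‖) * (κ.β j * (G + ‖s.x‖)) ≤ (2 * G ^ 2 + 2 * ‖s.x‖ ^ 2) * κ.β j := by
    nlinarith [mul_nonneg hb0 (sq_nonneg (G - ‖s.x‖))]
  have h10 := mul_le_mul_of_nonneg_left (h8.trans h9) hl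
  nlinarith

/-! ### From paths to the regret -/

theorem prob_nonneg {η : ℝ} (s : BatchState n N) (k : Fin N) : 0 ≤ s.prob η k := by
  unfold BatchState.prob
  split_ifs
  · exact div_nonneg (Real.exp_pos _).le (Finset.sum_nonneg fun _ _ => (Real.exp_pos _).le)
  · exact le_rfl

theorem sum_prob {η : ℝ} (s : BatchState n N) (h : s.pool.Nonempty) : ∑ k, s.prob η k = 1 := by
  unfold BatchState.prob
  rw [← Finset.sum_filter, Finset.filter_univ_mem, ← Finset.sum_div, div_self]
  exact (Finset.sum_pos (fun _ _ => Real.exp_pos _) h).ne'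

/-- The logarithm of the total weight relative to the weight of `i`. -/
def logPotential (η : ℝ) (i : Fin N) (s : BatchState n N) : ℝ :=
  Real.log (∑ j ∈ s.pool, Real.exp (-η * s.W j)) / η + s.W i

/-- The total weight is at least the single weight of `i`, which is still in the pool. -/
theorem logPotential_nonneg {η : ℝ} (hη : 0 < η) {i : Fin N} (hi : i ∈ s.pool) :
    0 ≤ logPotential η i s := by
  have h1 : Real.exp (-η * s.W i) ≤ ∑ j ∈ s.pool, Real.exp (-η * s.W j) :=
    Finset.single_le_sum (f := fun j => Real.exp (-η * s.W j))
      (fun _ _ => (Real.exp_pos _).le) hi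
  have h2 := Real.log_le_log (Real.exp_pos _) h1
  rw [Real.log_exp] at h2
  have h3 : -η * s.W i / η ≤ Real.log (∑ j ∈ s.pool, Real.exp (-η * s.W j)) / η := by gcongr
  have h4 : -η * s.W i / η = - s.W i := by field_simp
  unfold logPotential
  linarith

theorem batchStep_pool_subset {η : ℝ} : (P.batchStep κ T len η s k).pool ⊆ s.pool := by
  classical
  simp only [batchStep]
  split_ifs
  · exact Finset.erase_subset _ _
  · exact subset_rfl

theorem mem_batchStep_pool {η : ℝ} (hP : P.Admissible κ) {i : Fin N}
    (hiss : IsISSController κ P.f (P.policy i)) (hi : i ∈ s.pool) :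
    i ∈ (P.batchStep κ T len η s k).pool := by
  classical
  simp only [batchStep]
  split_ifs with h
  · refine Finset.mem_erase.2 ⟨?_, hi⟩
    rintro rfl
    exact not_breaks_of_isISS hP hiss h
  · exact hi

theorem extendSelection_ofNat {ι : Type*} (k₀ : ι) (T : ℕ) (K : Fin (T + 1) → ι) {b : ℕ}
    (hb : b < T + 1) : K (Fin.ofNat (T + 1) b) = extendSelection k₀ (T + 1) K b := by
  rw [extendSelection, dif_pos hb]
  congr 1
  ext
  simp [Fin.ofNat, Nat.mod_eq_of_lt hb]

/-- Removes the randomness. The potential starts at `log N / η`, so the expected batch costs exceed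
the counterfactual costs of `i` and the second-order terms by no more than that; these are then
bounded path by path. -/
theorem regret_le_of_forall_path (hP : P.Admissible κ) {τ : ℕ → ℕ} {η : ℝ} (hη : 0 < η)
    {i : Fin N} (hiss : IsISSController κ P.f (P.policy i)) {B : ℝ} (hB : 0 ≤ B)
    (hpath : ∀ K : ℕ → Fin N, (∀ b ≤ T, K b ∈ (P.runState κ T τ η K b).pool) →
      ∑ b ∈ Finset.range (T + 1), (P.batchCost κ T (τ b) (P.runState κ T τ η K b) i +
        η / 2 * ∑ j ∈ (P.runState κ T τ η K b).pool,
          P.batchCost κ T (τ b) (P.runState κ T τ η K b) j ^ 2) ≤ P.fixedCost T i + B) :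
    P.regret κ T τ η i ≤ Real.log N / η + B := by
  classical
  set s₀ : BatchState n N := { time := 0, x := P.x0, pool := Finset.univ, W := fun _ => 0 }
  set ℓ : ℕ → BatchState n N → Fin N → ℝ := fun b s k =>
    P.batchCost κ T (τ b) s k - P.batchCost κ T (τ b) s i -
      η / 2 * ∑ j ∈ s.pool, P.batchCost κ T (τ b) s j ^ 2 with hℓ
  set E : (Fin (T + 1) → Fin N) → ℕ → Fin N := fun K => extendSelection i (T + 1) K with hE
  have hrun0 : ∀ K : ℕ → Fin N, P.runState κ T τ η K 0 = s₀ := fun _ => rfl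
  have hruns : ∀ (K : ℕ → Fin N) b, P.runState κ T τ η K (b + 1) =
      P.batchStep κ T (τ b) η (P.runState κ T τ η K b) (K b) := fun _ _ => rfl
  have hI : ∀ b (s : BatchState n N) k, i ∈ s.pool → i ∈ (P.batchStep κ T (τ b) η s k).pool :=
    fun b s k h => mem_batchStep_pool hP hiss h
  have hIrun : ∀ (K : ℕ → Fin N) b, i ∈ (P.runState κ T τ η K b).pool := by
    intro K b
    induction b with
    | zero => exact Finset.mem_univ _
    | succ b ih => exact hI _ _ _ ih
  have hmain := expectation_add_potential_le i (fun b s k => P.batchStep κ T (τ b) η s k)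
    (P.runState κ T τ η) s₀ hrun0 hruns (fun s k => s.prob η k) ℓ (logPotential η i)
    (fun s => i ∈ s.pool) (Finset.mem_univ i) hI (fun s k => prob_nonneg s k)
    (fun s hs => sum_prob s ⟨i, hs⟩)
    (fun b s hs => expWeights_potential_step hη s.pool s.W (s.prob η)
      (fun k => P.batchCost κ T (τ b) s k) (fun k => batchCost_nonneg hP) hs (fun k => rfl)
      (fun k => (P.batchStep κ T (τ b) η s k).pool) (fun k => batchStep_pool_subset)
      (fun k => hI b s k hs) (fun k => (P.batchStep κ T (τ b) η s k).W) (fun k => by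
        simp only [batchStep]))
    (T + 1)
  -- Zero loss and constant potential `1`: the path probabilities sum to at most `1`.
  have hone := expectation_add_potential_le i (fun b s k => P.batchStep κ T (τ b) η s k)
    (P.runState κ T τ η) s₀ hrun0 hruns (fun s k => s.prob η k) (fun _ _ _ => 0) (fun _ => 1)
    (fun s => i ∈ s.pool) (Finset.mem_univ i) hI (fun s k => prob_nonneg s k)
    (fun s hs => sum_prob s ⟨i, hs⟩)
    (fun b s hs => by simp [sum_prob s ⟨i, hs⟩]) (T + 1)
  have hpot : logPotential η i s₀ = Real.log N / η := by simp [logPotential, s₀]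
  rw [hpot] at hmain
  simp only [Finset.sum_const_zero, zero_add, mul_one] at hone
  set p : (Fin (T + 1) → Fin N) → ℝ := fun K =>
    ∏ b ∈ Finset.range (T + 1), (P.runState κ T τ η (E K) b).prob η (E K b) with hp
  have hp0 : ∀ K, 0 ≤ p K := fun K => Finset.prod_nonneg fun b _ => prob_nonneg _ _
  have hEK : ∀ (K : Fin (T + 1) → Fin N), ∀ b ∈ Finset.range (T + 1),
      P.runState κ T τ η (fun b => K (Fin.ofNat (T + 1) b)) b = P.runState κ T τ η (E K) b ∧
      K (Fin.ofNat (T + 1) b) = E K b := by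
    intro K b hb
    rw [Finset.mem_range] at hb
    exact ⟨congr_of_adapted hrun0 hruns fun a ha => extendSelection_ofNat i T K (by omega),
      extendSelection_ofNat i T K hb⟩
  have hterm : ∀ K : Fin (T + 1) → Fin N,
      P.runProb κ T τ η (fun b => K (Fin.ofNat (T + 1) b)) *
        (P.runCost κ T τ η (fun b => K (Fin.ofNat (T + 1) b)) - P.fixedCost T i) ≤
      p K * (∑ b ∈ Finset.range (T + 1), ℓ b (P.runState κ T τ η (E K) b) (E K b) +
        logPotential η i (P.runState κ T τ η (E K) (T + 1))) + p K * B := by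
    intro K
    have h1 : P.runProb κ T τ η (fun b => K (Fin.ofNat (T + 1) b)) = p K :=
      Finset.prod_congr rfl fun b hb => by
        rw [(hEK K b hb).1]; exact congrArg _ (hEK K b hb).2
    have h2 : P.runCost κ T τ η (fun b => K (Fin.ofNat (T + 1) b)) =
        ∑ b ∈ Finset.range (T + 1), P.batchCost κ T (τ b) (P.runState κ T τ η (E K) b) (E K b) :=
      Finset.sum_congr rfl fun b hb => by
        rw [(hEK K b hb).1]; exact congrArg _ (hEK K b hb).2
    rw [h1, h2, ← mul_add]
    -- Paths of probability zero contribute nothing; on all others every selection lies in the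
    -- current pool, as `hpath` requires.
    rcases (hp0 K).eq_or_lt with h | h
    · rw [← h]; simp
    refine mul_le_mul_of_nonneg_left ?_ h.le
    have hmem : ∀ b ≤ T, E K b ∈ (P.runState κ T τ η (E K) b).pool := by
      intro b hb
      by_contra hc
      refine h.ne' (Finset.prod_eq_zero (Finset.mem_range.2 (Nat.lt_succ_of_le hb)) ?_)
      rw [BatchState.prob, if_neg hc]
    have h3 := hpath (E K) hmem
    have h4 := logPotential_nonneg hη (hIrun (E K) (T + 1))
    have h5 : ∑ b ∈ Finset.range (T + 1), ℓ b (P.runState κ T τ η (E K) b) (E K b) =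
        ∑ b ∈ Finset.range (T + 1), P.batchCost κ T (τ b) (P.runState κ T τ η (E K) b) (E K b) -
        ∑ b ∈ Finset.range (T + 1), (P.batchCost κ T (τ b) (P.runState κ T τ η (E K) b) i +
        η / 2 * ∑ j ∈ (P.runState κ T τ η (E K) b).pool,
          P.batchCost κ T (τ b) (P.runState κ T τ η (E K) b) j ^ 2) := by
      rw [← Finset.sum_sub_distrib]
      refine Finset.sum_congr rfl fun b _ => ?_
      rw [hℓ]
      ring
    linarith
  refine (Finset.sum_le_sum fun K _ => hterm K).trans ?_
  rw [Finset.sum_add_distrib, ← Finset.sum_mul]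
  have h6 := mul_le_mul_of_nonneg_right hone hB
  rw [one_mul] at h6
  exact add_le_add hmain h6

end ControlProblem

/-! ### A sequence that contracts except at finitely many times -/

open Classical in
/-- The number of indices below `m` with the property `q`. -/
def countBelow (q : ℕ → Prop) (m : ℕ) : ℕ := ((Finset.range m).filter q).card

theorem countBelow_zero (q : ℕ → Prop) : countBelow q 0 = 0 := by simp [countBelow]

theorem countBelow_succ_of {q : ℕ → Prop} {m : ℕ} (h : q m) :
    countBelow q (m + 1) = countBelow q m + 1 := by
  classical
  rw [countBelow, Finset.range_add_one, Finset.filter_insert, if_pos h,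
    Finset.card_insert_of_notMem (by simp), countBelow]

theorem countBelow_succ_of_not {q : ℕ → Prop} {m : ℕ} (h : ¬ q m) :
    countBelow q (m + 1) = countBelow q m := by
  classical
  rw [countBelow, Finset.range_add_one, Finset.filter_insert, if_neg h, countBelow]

theorem countBelow_le (q : ℕ → Prop) (m : ℕ) : countBelow q m ≤ m := by
  classical
  exact (Finset.card_filter_le _ _).trans_eq (Finset.card_range m)

theorem add_pow_four_le (a b : ℝ) : (a + b) ^ 4 ≤ 8 * a ^ 4 + 8 * b ^ 4 := by
  nlinarith [sq_nonneg (a - b), sq_nonneg (a + b), sq_nonneg (a ^ 2 - b ^ 2),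
    mul_nonneg (sq_nonneg (a - b)) (sq_nonneg (a + b)), sq_nonneg ((a - b) ^ 2)]

theorem sum_pow_four_le_of_contract {v : ℕ → ℝ} {q : ℕ → Prop} {A E : ℝ} (hv : ∀ b, 0 ≤ v b)
    (h0 : v 0 = 0) (h1 : ∀ b, ¬ q b → v (b + 1) ≤ 3 / 4 * v b)
    (h2 : ∀ b, q b → v (b + 1) ≤ A * v b + E) (m : ℕ) :
    ∑ b ∈ Finset.range m, v b ^ 4 ≤ (1 + 8 * A ^ 4 + 16 * E ^ 4) ^ countBelow q m := by
  have hA : 0 ≤ A ^ 4 := by positivity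
  have hE : 0 ≤ E ^ 4 := by positivity
  -- The term `2 * v m ^ 4` pays for the next summand, since `1 + 2 * (3/4)^4 ≤ 2`. The `1` lets the
  -- additive `E` at a jump be absorbed into the factor.
  have key : ∑ b ∈ Finset.range m, v b ^ 4 + 2 * v m ^ 4 + 1 ≤
      (1 + 8 * A ^ 4 + 16 * E ^ 4) ^ countBelow q m := by
    induction m with
    | zero => simp [h0, countBelow_zero]
    | succ m ih =>
      have hS : 0 ≤ ∑ b ∈ Finset.range m, v b ^ 4 :=
        Finset.sum_nonneg fun b _ => pow_nonneg (hv b) 4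
      have hm : 0 ≤ v m ^ 4 := pow_nonneg (hv m) 4
      rw [Finset.sum_range_succ]
      by_cases hq : q m
      · rw [countBelow_succ_of hq, pow_succ (1 + 8 * A ^ 4 + 16 * E ^ 4)]
        have h3 : v (m + 1) ^ 4 ≤ (A * v m + E) ^ 4 := pow_le_pow_left₀ (hv _) (h2 m hq) 4
        have h4 := add_pow_four_le (A * v m) E
        rw [mul_pow] at h4
        have h5 := mul_le_mul_of_nonneg_right ih
          (show 0 ≤ 1 + 8 * A ^ 4 + 16 * E ^ 4 by positivity)
        nlinarith [mul_nonneg hA hS, mul_nonneg hE hS, mul_nonneg hE hm]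
      · rw [countBelow_succ_of_not hq]
        have h3 : v (m + 1) ^ 4 ≤ (3 / 4 * v m) ^ 4 := pow_le_pow_left₀ (hv _) (h1 m hq) 4
        rw [mul_pow] at h3
        norm_num at h3
        linarith
  have := pow_nonneg (hv m) 4
  linarith

/-! ### Time and pool along a path -/

namespace ControlProblem

variable {n m g N : ℕ} {P : ControlProblem n m g N} {κ : ModelConstants}
variable {T : ℕ} {τ : ℕ → ℕ} {η : ℝ} {K : ℕ → Fin N}

theorem runState_time_succ (b : ℕ) : (P.runState κ T τ η K (b + 1)).time =
    (P.runState κ T τ η K b).time +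
      P.batchLength κ T (τ b) (P.runState κ T τ η K b) (K b) := rfl

theorem runState_x_succ (b : ℕ) : (P.runState κ T τ η K (b + 1)).x =
    P.batchTraj (P.runState κ T τ η K b) (K b)
      (P.batchLength κ T (τ b) (P.runState κ T τ η K b) (K b)) := rfl

theorem runState_time_le (b : ℕ) : (P.runState κ T τ η K b).time ≤ T + 1 := by
  induction b with
  | zero => exact Nat.zero_le _
  | succ b ih =>
    rw [runState_time_succ]
    have := batchLength_le (P := P) (κ := κ) (T := T) (len := τ b)
      (s := P.runState κ T τ η K b) (k := K b)
    omega

variable (P κ T τ η K) in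
/-- The length that batch `b` has if the stability test is never failed. -/
def fullLength (b : ℕ) : ℕ := min (τ b) (T + 1 - (P.runState κ T τ η K b).time)

variable (P κ T τ η K) in
/-- Batch `b` ends with the falsification of its controller. -/
def batchBreaks (b : ℕ) : Prop := P.breaks κ T (τ b) (P.runState κ T τ η K b) (K b)

theorem runState_time_succ_of_not_breaks {b : ℕ} (h : ¬ P.batchBreaks κ T τ η K b) :
    (P.runState κ T τ η K (b + 1)).time =
      (P.runState κ T τ η K b).time + P.fullLength κ T τ η K b := by
  rw [runState_time_succ, batchLength_of_not_breaks h, fullLength]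

/-- A break moves one controller from the second count to the first: the selected one is in the pool
by `hK`, is destabilizing because the test failed, and is erased. -/
theorem countBelow_breaks_add_card_le (hP : P.Admissible κ) (b : ℕ)
    (hK : ∀ a < b, K a ∈ (P.runState κ T τ η K a).pool) :
    countBelow (P.batchBreaks κ T τ η K) b +
      ((P.runState κ T τ η K b).pool ∩ P.destabilizing κ).card ≤ (P.destabilizing κ).card := by
  classical
  induction b with
  | zero =>
    rw [countBelow_zero, zero_add]
    exact Finset.card_le_card Finset.inter_subset_right
  | succ b ih =>
    have ih := ih fun a ha => hK a (by omega)
    by_cases h : P.batchBreaks κ T τ η K b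
    · rw [countBelow_succ_of h]
      have hpool : (P.runState κ T τ η K (b + 1)).pool =
          (P.runState κ T τ η K b).pool.erase (K b) := by
        change (if P.breaks κ T (τ b) (P.runState κ T τ η K b) (K b) then _ else _) = _
        exact if_pos h
      have hmem : K b ∈ (P.runState κ T τ η K b).pool ∩ P.destabilizing κ :=
        Finset.mem_inter.2 ⟨hK b (by omega), mem_destabilizing_of_breaks hP h⟩
      rw [hpool, Finset.erase_inter, Finset.card_erase_of_mem hmem]
      have := Finset.card_pos.2 ⟨_, hmem⟩
      omega
    · rw [countBelow_succ_of_not h]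
      refine le_trans ?_ ih
      gcongr
      exact batchStep_pool_subset

/-- Unbroken batches before an active one were not cut by the horizon, so they lasted their full `τ
a`. Since `τ` is monotone, replacing them by the first `b - countBelow` indices only lowers the sum.
-/
theorem sum_tau_le_time (hτ : Monotone τ) (b : ℕ)
    (hb : (P.runState κ T τ η K b).time ≤ T) :
    ∑ a ∈ Finset.range (b - countBelow (P.batchBreaks κ T τ η K) b), τ a ≤
      (P.runState κ T τ η K b).time := by
  induction b with
  | zero => simp
  | succ b ih =>
    have hle := runState_time_succ (P := P) (κ := κ) (T := T) (τ := τ) (η := η) (K := K) b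
    have ih := ih (by omega)
    by_cases h : P.batchBreaks κ T τ η K b
    · rw [countBelow_succ_of h, Nat.add_sub_add_right]
      omega
    · have hc := countBelow_le (P.batchBreaks κ T τ η K) b
      rw [countBelow_succ_of_not h, Nat.sub_add_comm hc, Finset.sum_range_succ]
      have hmono := hτ (Nat.sub_le b (countBelow (P.batchBreaks κ T τ η K) b))
      have h2 := runState_time_succ_of_not_breaks h
      unfold fullLength at h2
      omega

open Classical in
theorem sum_fullLength_not_breaks_le (b : ℕ) :
    ∑ a ∈ Finset.range b, (if P.batchBreaks κ T τ η K a then 0 else P.fullLength κ T τ η K a) ≤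
      (P.runState κ T τ η K b).time := by
  induction b with
  | zero => simp
  | succ b ih =>
    rw [Finset.sum_range_succ]
    split_ifs with h
    · rw [runState_time_succ]
      omega
    · rw [runState_time_succ_of_not_breaks h]
      omega

-- An unbroken batch occupies exactly its window `[t_b, t_b + D)`, so these windows are disjoint. A
-- broken batch is left out because its full window overlaps later ones.
open Classical in
theorem sum_range_not_breaks_le {c : ℕ → ℝ} (hc : ∀ t, 0 ≤ c t) (b : ℕ) :
    ∑ a ∈ Finset.range b, (if P.batchBreaks κ T τ η K a then 0 else
      ∑ j ∈ Finset.range (P.fullLength κ T τ η K a), c ((P.runState κ T τ η K a).time + j)) ≤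
      ∑ t ∈ Finset.range (P.runState κ T τ η K b).time, c t := by
  induction b with
  | zero => simp [runState]
  | succ b ih =>
    rw [Finset.sum_range_succ]
    split_ifs with h
    · rw [add_zero]
      refine ih.trans (Finset.sum_le_sum_of_subset_of_nonneg ?_ fun t _ _ => hc t)
      rw [Finset.range_subset_range, runState_time_succ]
      omega
    · rw [runState_time_succ_of_not_breaks h, Finset.sum_range_add]
      linarith

open Classical in
theorem sum_fullLength_breaks_le {Θ : ℝ} (b : ℕ)
    (hΘ : ∀ a < b, (P.fullLength κ T τ η K a : ℝ) ≤ Θ) :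
    ∑ a ∈ Finset.range b, (if P.batchBreaks κ T τ η K a then (P.fullLength κ T τ η K a : ℝ) else 0) ≤
      countBelow (P.batchBreaks κ T τ η K) b * Θ := by
  rw [← Finset.sum_filter, countBelow, ← nsmul_eq_mul]
  exact Finset.sum_le_card_nsmul _ _ _ fun a ha =>
    hΘ a (Finset.mem_range.1 (Finset.mem_filter.1 ha).1)

/-! ### States along a path -/

/-- A level that the states exceed only in the aftermath of a falsification. -/
def stateLevel (κ : ModelConstants) : ℝ := 4 * (κ.γ * κ.wMax) + |κ.x0Max|

theorem stateLevel_nonneg (κ : ModelConstants) : 0 ≤ stateLevel κ := by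
  have := κ.γw_pos
  unfold stateLevel
  positivity

variable (P κ T τ η K) in
/-- The excess of the state at the start of batch `b` over `stateLevel`. -/
def excess (b : ℕ) : ℝ :=
  if (P.runState κ T τ η K b).time ≤ T then max (‖(P.runState κ T τ η K b).x‖ - stateLevel κ) 0
  else 0

theorem excess_nonneg (b : ℕ) : 0 ≤ P.excess κ T τ η K b := by
  unfold excess
  split_ifs
  · exact le_max_right _ _
  · exact le_rfl

theorem norm_runState_le {b : ℕ} (h : (P.runState κ T τ η K b).time ≤ T) :
    ‖(P.runState κ T τ η K b).x‖ ≤ stateLevel κ + P.excess κ T τ η K b := by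
  rw [excess, if_pos h]
  linarith [le_max_left (‖(P.runState κ T τ η K b).x‖ - stateLevel κ) 0]

theorem excess_zero (hP : P.Admissible κ) : P.excess κ T τ η K 0 = 0 := by
  have h0 : (P.runState κ T τ η K 0).time ≤ T := Nat.zero_le _
  rw [excess, if_pos h0]
  refine max_eq_right ?_
  change ‖P.x0‖ - stateLevel κ ≤ 0
  have := κ.γw_pos
  unfold stateLevel
  linarith [hP.x0_bound, le_abs_self κ.x0Max]

/-- The level is at least `4 γ wMax`, so `3/4 * level + γ wMax ≤ level`. If the next batch is
active, this one ran for all of `τ b` steps; a batch cut by the horizon is harmless since the excess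
is then set to `0`. -/
theorem excess_succ_le_of_not_breaks (hτ : ∀ b, κ.β (τ b) ≤ 3 / 4) {b : ℕ}
    (h : ¬ P.batchBreaks κ T τ η K b) :
    P.excess κ T τ η K (b + 1) ≤ 3 / 4 * P.excess κ T τ η K b := by
  by_cases hb : (P.runState κ T τ η K (b + 1)).time ≤ T
  · have ht := runState_time_succ_of_not_breaks h
    have hfull : P.fullLength κ T τ η K b = τ b := by
      unfold fullLength at ht ⊢
      omega
    have hb' : (P.runState κ T τ η K b).time ≤ T := by omega
    have hx := norm_batchTraj_le_of_not_breaks h le_rfl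
    have hx' : ‖(P.runState κ T τ η K (b + 1)).x‖ ≤
        κ.β (τ b) * ‖(P.runState κ T τ η K b).x‖ + κ.γ * κ.wMax := by
      rw [runState_x_succ, batchLength_of_not_breaks h]
      refine hx.trans_eq ?_
      change κ.β (P.fullLength κ T τ η K b) * _ + _ = _
      rw [hfull]
    have h1 := mul_le_mul_of_nonneg_right (hτ b) (norm_nonneg (P.runState κ T τ η K b).x)
    have h2 := norm_runState_le hb'
    rw [excess, if_pos hb]
    refine max_le ?_ (mul_nonneg (by norm_num) (excess_nonneg b))
    have : 0 ≤ |κ.x0Max| := abs_nonneg _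
    unfold stateLevel at h2 ⊢
    linarith
  · rw [excess, if_neg hb]
    exact mul_nonneg (by norm_num) (excess_nonneg b)

theorem time_le_of_batchBreaks {b : ℕ} (h : P.batchBreaks κ T τ η K b) :
    (P.runState κ T τ η K b).time ≤ T := by
  obtain ⟨j, hj, -⟩ := h
  omega

/-- The additive constant in the growth of the excess at a falsification. -/
def jumpConst (κ : ModelConstants) : ℝ :=
  κ.Lf * (1 + |κ.Lπ|) * (stateLevel κ + κ.γ * κ.wMax) + (κ.Lf * (κ.π0Max + κ.wMax) + |κ.f0|)

theorem jumpConst_nonneg (κ : ModelConstants) : 0 ≤ jumpConst κ := by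
  have := κ.one_le_Lf
  have := stateLevel_nonneg κ
  have := κ.γw_pos
  have := κ.π0Max_nonneg
  have := κ.wMax_pos
  unfold jumpConst
  positivity

theorem excess_succ_le_of_breaks (hP : P.Admissible κ) {b : ℕ}
    (h : P.batchBreaks κ T τ η K b) :
    P.excess κ T τ η K (b + 1) ≤
      κ.Lf * (1 + |κ.Lπ|) * P.excess κ T τ η K b + jumpConst κ := by
  have hL : 0 ≤ κ.Lf * (1 + |κ.Lπ|) := by
    have := κ.one_le_Lf
    positivity
  have hnn : 0 ≤ κ.Lf * (1 + |κ.Lπ|) * P.excess κ T τ η K b + jumpConst κ :=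
    add_nonneg (mul_nonneg hL (excess_nonneg b)) (jumpConst_nonneg κ)
  by_cases hb : (P.runState κ T τ η K (b + 1)).time ≤ T
  · rw [excess, if_pos hb]
    refine max_le ?_ hnn
    have hx := norm_next_le_of_breaks hP h
    rw [← runState_x_succ] at hx
    have h2 := norm_runState_le (time_le_of_batchBreaks h)
    have h3 := mul_le_mul_of_nonneg_left h2 hL
    have := stateLevel_nonneg κ
    unfold jumpConst
    linarith
  · rw [excess, if_neg hb]
    exact hnn

/-- The base of the exponential in the number of destabilizing controllers. -/
def jumpBase (κ : ModelConstants) : ℝ :=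
  1 + 8 * (κ.Lf * (1 + |κ.Lπ|)) ^ 4 + 16 * jumpConst κ ^ 4

theorem one_le_jumpBase (κ : ModelConstants) : 1 ≤ jumpBase κ := by
  have h1 : 0 ≤ (κ.Lf * (1 + |κ.Lπ|)) ^ 4 := by positivity
  have h2 : 0 ≤ jumpConst κ ^ 4 := by positivity
  unfold jumpBase
  linarith

theorem sum_excess_pow_four_le (hP : P.Admissible κ) (hτ : ∀ b, κ.β (τ b) ≤ 3 / 4)
    (hK : ∀ b ≤ T, K b ∈ (P.runState κ T τ η K b).pool) :
    ∑ b ∈ Finset.range (T + 1), P.excess κ T τ η K b ^ 4 ≤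
      jumpBase κ ^ (P.destabilizing κ).card := by
  refine (sum_pow_four_le_of_contract (q := P.batchBreaks κ T τ η K) excess_nonneg
    (excess_zero hP) (fun b h => excess_succ_le_of_not_breaks hτ h)
    (fun b h => excess_succ_le_of_breaks hP h) (T + 1)).trans ?_
  refine pow_le_pow_right₀ (one_le_jumpBase κ) ?_
  have := countBelow_breaks_add_card_le hP (T + 1) fun a ha => hK a (by omega)
  omega

end ControlProblem

/-! ### Batch costs along a path -/

namespace ControlProblem

/-- The constant of the bound for the cost of a batch. -/
def batchConst (κ : ModelConstants) : ℝ :=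
  growthConst κ * (1 + 2 * (κ.γ * κ.wMax) ^ 2) + 2 * growthConst κ

/-- The constant of the bound for the cost of a batch relative to the benchmark. -/
def compareConst (κ : ModelConstants) : ℝ :=
  lipConst κ * (2 * (1 + 2 * (κ.γ * κ.wMax) + |κ.x0Max|) ^ 2 + 2)

/-- The constant in the bound for powers of the state. -/
def levelConst (κ : ModelConstants) : ℝ := 8 * (1 + stateLevel κ ^ 4)

theorem batchConst_nonneg (κ : ModelConstants) : 0 ≤ batchConst κ := by
  have := growthConst_nonneg κ
  unfold batchConst
  positivity

theorem compareConst_nonneg (κ : ModelConstants) : 0 ≤ compareConst κ := by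
  have := lipConst_nonneg κ
  unfold compareConst
  positivity

theorem levelConst_nonneg (κ : ModelConstants) : 0 ≤ levelConst κ := by
  unfold levelConst
  positivity

variable {n m g N : ℕ} {P : ControlProblem n m g N} {κ : ModelConstants}
variable {T : ℕ} {τ : ℕ → ℕ} {η : ℝ} {K : ℕ → Fin N}

theorem fullLength_eq_zero {b : ℕ} (h : ¬ (P.runState κ T τ η K b).time ≤ T) :
    P.fullLength κ T τ η K b = 0 := by
  unfold fullLength
  omega

theorem norm_runState_sq_le {b : ℕ} (h : (P.runState κ T τ η K b).time ≤ T) :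
    ‖(P.runState κ T τ η K b).x‖ ^ 2 ≤ levelConst κ * (1 + P.excess κ T τ η K b ^ 4) := by
  have h1 := norm_runState_le h
  have h2 : ‖(P.runState κ T τ η K b).x‖ ^ 2 ≤ (stateLevel κ + P.excess κ T τ η K b) ^ 2 := by
    gcongr
  unfold levelConst
  set a := stateLevel κ
  set v := P.excess κ T τ η K b
  nlinarith [sq_nonneg (a - v), sq_nonneg (a ^ 2 - 1), sq_nonneg (v ^ 2 - 1),
    mul_nonneg (sq_nonneg (a ^ 2)) (sq_nonneg (v ^ 2)), sq_nonneg (a ^ 2), sq_nonneg (v ^ 2)]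

theorem norm_runState_pow_four_le {b : ℕ} (h : (P.runState κ T τ η K b).time ≤ T) :
    ‖(P.runState κ T τ η K b).x‖ ^ 4 ≤ levelConst κ * (1 + P.excess κ T τ η K b ^ 4) := by
  have h1 := norm_runState_le h
  have h2 : ‖(P.runState κ T τ η K b).x‖ ^ 4 ≤ (stateLevel κ + P.excess κ T τ η K b) ^ 4 := by
    gcongr
  have h3 := add_pow_four_le (stateLevel κ) (P.excess κ T τ η K b)
  unfold levelConst
  have h4 : 0 ≤ stateLevel κ ^ 4 * P.excess κ T τ η K b ^ 4 := by positivity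
  linarith

/-- The base level keeps the actual `H(D_b)`, which is summed over all batches later. Only the
excess, whose fourth powers are summable, takes the uniform bound `Hm`. -/
theorem H_mul_sq_le {Hm : ℝ} (b : ℕ) (hHm : κ.H (P.fullLength κ T τ η K b) ≤ Hm) :
    κ.H (P.fullLength κ T τ η K b) * ‖(P.runState κ T τ η K b).x‖ ^ 2 ≤
      levelConst κ * (κ.H (P.fullLength κ T τ η K b) + Hm * P.excess κ T τ η K b ^ 4) := by
  have hG := levelConst_nonneg κ
  have hv := pow_nonneg (excess_nonneg (P := P) (κ := κ) (T := T) (τ := τ) (η := η) (K := K) b) 4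
  have hH := κ.H_nonneg (P.fullLength κ T τ η K b)
  by_cases h : (P.runState κ T τ η K b).time ≤ T
  · have h1 := mul_le_mul_of_nonneg_left (norm_runState_sq_le h) hH
    have h2 := mul_le_mul_of_nonneg_left (mul_le_mul_of_nonneg_right hHm hv) hG
    linarith
  · have h0 : κ.H (P.fullLength κ T τ η K b) = 0 := by rw [fullLength_eq_zero h, κ.H_zero]
    rw [h0] at hHm ⊢
    rw [zero_mul, zero_add]
    positivity

/-- On the excess only one of the two factors `H` is replaced by `Θ`; the remaining `Hm` is what
becomes `o(T^{1/3})`. -/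
theorem H_sq_mul_pow_four_le {Hm Θ : ℝ} (b : ℕ) (hHm : κ.H (P.fullLength κ T τ η K b) ≤ Hm)
    (hΘ : (P.fullLength κ T τ η K b : ℝ) ≤ Θ) :
    κ.H (P.fullLength κ T τ η K b) ^ 2 * ‖(P.runState κ T τ η K b).x‖ ^ 4 ≤
      levelConst κ * ((P.fullLength κ T τ η K b : ℝ) ^ 2 +
        Θ * Hm * P.excess κ T τ η K b ^ 4) := by
  have hG := levelConst_nonneg κ
  have hv := pow_nonneg (excess_nonneg (P := P) (κ := κ) (T := T) (τ := τ) (η := η) (K := K) b) 4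
  have hH := κ.H_nonneg (P.fullLength κ T τ η K b)
  have hHD := κ.H_le (P.fullLength κ T τ η K b)
  have hD : (0 : ℝ) ≤ P.fullLength κ T τ η K b := Nat.cast_nonneg _
  by_cases h : (P.runState κ T τ η K b).time ≤ T
  · have h1 := mul_le_mul_of_nonneg_left (norm_runState_pow_four_le h)
      (sq_nonneg (κ.H (P.fullLength κ T τ η K b)))
    have h2 : κ.H (P.fullLength κ T τ η K b) ^ 2 ≤ (P.fullLength κ T τ η K b : ℝ) ^ 2 := by gcongr
    have h3 : κ.H (P.fullLength κ T τ η K b) ^ 2 ≤ Θ * Hm := by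
      rw [sq]
      exact mul_le_mul (hHD.trans hΘ) hHm hH (hD.trans hΘ)
    have h4 := mul_le_mul_of_nonneg_left h2 hG
    have h5 := mul_le_mul_of_nonneg_left (mul_le_mul_of_nonneg_right h3 hv) hG
    linarith
  · have h0 : κ.H (P.fullLength κ T τ η K b) = 0 := by rw [fullLength_eq_zero h, κ.H_zero]
    rw [h0] at hHm ⊢
    have hΘ0 := hD.trans hΘ
    rw [zero_pow two_ne_zero, zero_mul]
    positivity

theorem batchCost_runState_le (hP : P.Admissible κ) (b : ℕ) (k : Fin N) :
    P.batchCost κ T (τ b) (P.runState κ T τ η K b) k ≤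
      batchConst κ * (P.fullLength κ T τ η K b +
        κ.H (P.fullLength κ T τ η K b) * ‖(P.runState κ T τ η K b).x‖ ^ 2) := by
  have h := batchCost_le (T := T) (len := τ b) (s := P.runState κ T τ η K b) (k := k) hP
  change _ ≤ growthConst κ * (1 + 2 * (κ.γ * κ.wMax) ^ 2) * (P.fullLength κ T τ η K b : ℝ) +
    2 * growthConst κ * ‖(P.runState κ T τ η K b).x‖ ^ 2 * κ.H (P.fullLength κ T τ η K b) at h
  have hC := growthConst_nonneg κ
  have hH := κ.H_nonneg (P.fullLength κ T τ η K b)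
  have h1 : 0 ≤ growthConst κ * (1 + 2 * (κ.γ * κ.wMax) ^ 2) *
      (κ.H (P.fullLength κ T τ η K b) * ‖(P.runState κ T τ η K b).x‖ ^ 2) := by positivity
  have h2 : 0 ≤ 2 * growthConst κ * (P.fullLength κ T τ η K b : ℝ) := by positivity
  unfold batchConst
  linarith

theorem batchCost_sq_le (hP : P.Admissible κ) {Hm Θ : ℝ} (b : ℕ)
    (hHm : κ.H (P.fullLength κ T τ η K b) ≤ Hm)
    (hΘ : (P.fullLength κ T τ η K b : ℝ) ≤ Θ) (k : Fin N) :
    P.batchCost κ T (τ b) (P.runState κ T τ η K b) k ^ 2 ≤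
      2 * batchConst κ ^ 2 * (1 + levelConst κ) *
        ((P.fullLength κ T τ η K b : ℝ) ^ 2 + Θ * Hm * P.excess κ T τ η K b ^ 4) := by
  have h1 := pow_le_pow_left₀ (batchCost_nonneg hP)
    (batchCost_runState_le (T := T) (τ := τ) (η := η) (K := K) hP b k) 2
  have h2 := H_sq_mul_pow_four_le b hHm hΘ
  have hv := pow_nonneg (excess_nonneg (P := P) (κ := κ) (T := T) (τ := τ) (η := η) (K := K) b) 4
  have hH := κ.H_nonneg (P.fullLength κ T τ η K b)
  have hD : (0 : ℝ) ≤ P.fullLength κ T τ η K b := Nat.cast_nonneg _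
  have h3 : 0 ≤ Θ * Hm * P.excess κ T τ η K b ^ 4 :=
    mul_nonneg (mul_nonneg (hD.trans hΘ) (hH.trans hHm)) hv
  refine h1.trans ?_
  rw [mul_pow]
  have h4 := add_sq_le (a := (P.fullLength κ T τ η K b : ℝ))
    (b := κ.H (P.fullLength κ T τ η K b) * ‖(P.runState κ T τ η K b).x‖ ^ 2)
  rw [mul_pow, ← pow_mul, show 2 * 2 = 4 from rfl] at h4
  have h5 : ((P.fullLength κ T τ η K b : ℝ) +
      κ.H (P.fullLength κ T τ η K b) * ‖(P.runState κ T τ η K b).x‖ ^ 2) ^ 2 ≤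
      2 * ((1 + levelConst κ) * ((P.fullLength κ T τ η K b : ℝ) ^ 2 +
        Θ * Hm * P.excess κ T τ η K b ^ 4)) := by
    linarith
  refine (mul_le_mul_of_nonneg_left h5 (sq_nonneg _)).trans_eq ?_
  ring

-- In an unbroken batch the benchmark cost of the window is charged. In a broken one the comparator
-- would run past the break into later windows, so the crude cost bound is used; this happens at
-- most `|𝒰|` times.
open Classical in
theorem batchCost_benchmark_le (hP : P.Admissible κ) {i : Fin N} (hi : i ∈ P.stabilizing κ)
    {Hm : ℝ} (b : ℕ) (hHm : κ.H (P.fullLength κ T τ η K b) ≤ Hm) :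
    P.batchCost κ T (τ b) (P.runState κ T τ η K b) i ≤
      (if P.batchBreaks κ T τ η K b then 0 else
        ∑ j ∈ Finset.range (P.fullLength κ T τ η K b),
          P.cost ((P.runState κ T τ η K b).time + j)
            (closedLoop P.f (P.policy i) P.noise P.x0 ((P.runState κ T τ η K b).time + j))
            (P.policy i
              (closedLoop P.f (P.policy i) P.noise P.x0 ((P.runState κ T τ η K b).time + j)))) +
      batchConst κ * (if P.batchBreaks κ T τ η K b then (P.fullLength κ T τ η K b : ℝ) else 0) +
      (batchConst κ + compareConst κ) * (1 + levelConst κ) *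
        (κ.H (P.fullLength κ T τ η K b) + Hm * P.excess κ T τ η K b ^ 4) := by
  have h1 := batchCost_runState_le (T := T) (τ := τ) (η := η) (K := K) hP b i
  have h2 := batchCost_stabilizing_le (T := T) (len := τ b) (s := P.runState κ T τ η K b) hP hi
  change _ ≤ ∑ j ∈ Finset.range (P.fullLength κ T τ η K b), _ +
    _ * κ.H (P.fullLength κ T τ η K b) at h2
  have h3 := H_mul_sq_le b hHm
  have hH := κ.H_nonneg (P.fullLength κ T τ η K b)
  have hv : 0 ≤ Hm * P.excess κ T τ η K b ^ 4 :=
    mul_nonneg (hH.trans hHm) (pow_nonneg (excess_nonneg b) 4)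
  have hb := batchConst_nonneg κ
  have hc := compareConst_nonneg κ
  have hl := levelConst_nonneg κ
  set H := κ.H (P.fullLength κ T τ η K b)
  set E := Hm * P.excess κ T τ η K b ^ 4
  set y := ‖(P.runState κ T τ η K b).x‖
  have h4 : batchConst κ * (H * y ^ 2) ≤ batchConst κ * ((1 + levelConst κ) * (H + E)) := by
    refine mul_le_mul_of_nonneg_left ?_ hb
    linarith
  have h5 : compareConst κ * (H + H * y ^ 2) ≤ compareConst κ * ((1 + levelConst κ) * (H + E)) := by
    refine mul_le_mul_of_nonneg_left ?_ hc
    linarith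
  have h6 : 0 ≤ batchConst κ * ((1 + levelConst κ) * (H + E)) := by positivity
  have h7 : 0 ≤ compareConst κ * ((1 + levelConst κ) * (H + E)) := by positivity
  split_ifs
  · linarith
  · have h8 : lipConst κ * (2 * (1 + 2 * (κ.γ * κ.wMax) + |κ.x0Max|) ^ 2 + 2 * y ^ 2) * H ≤
        compareConst κ * (H + H * y ^ 2) := by
      have hlc := lipConst_nonneg κ
      have h9 : 0 ≤ lipConst κ * (2 * (1 + 2 * (κ.γ * κ.wMax) + |κ.x0Max|) ^ 2) * (H * y ^ 2) := by
        positivity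
      have h10 : 0 ≤ lipConst κ * H := by positivity
      unfold compareConst
      linarith
    linarith

-- The affine bound on `H` charges `lam` per active batch and `rho` per unit of full length. Full
-- lengths total at most `T + 1 + |𝒰| Θ`, the excess accounting for broken batches.
open Classical in
theorem path_cost_le (hP : P.Admissible κ) {i : Fin N} (hi : i ∈ P.stabilizing κ)
    (hη : 0 ≤ η) (hτ : ∀ b, κ.β (τ b) ≤ 3 / 4)
    (hK : ∀ b ≤ T, K b ∈ (P.runState κ T τ η K b).pool)
    {Hm Θ nb lam rho : ℝ} (hlam : 0 ≤ lam) (hrho : 0 ≤ rho)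
    (hHm : ∀ b ≤ T, κ.H (P.fullLength κ T τ η K b) ≤ Hm)
    (hΘ : ∀ b ≤ T, (P.fullLength κ T τ η K b : ℝ) ≤ Θ)
    (hnb : (((Finset.range (T + 1)).filter
      fun b => (P.runState κ T τ η K b).time ≤ T).card : ℝ) ≤ nb)
    (hH : ∀ b, κ.H (P.fullLength κ T τ η K b) ≤ lam + rho * P.fullLength κ T τ η K b) :
    ∑ b ∈ Finset.range (T + 1), (P.batchCost κ T (τ b) (P.runState κ T τ η K b) i +
        η / 2 * ∑ j ∈ (P.runState κ T τ η K b).pool,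
          P.batchCost κ T (τ b) (P.runState κ T τ η K b) j ^ 2) ≤
      P.fixedCost T i +
      (batchConst κ * ((P.destabilizing κ).card * Θ) +
      (batchConst κ + compareConst κ) * (1 + levelConst κ) *
        (nb * lam + rho * (T + 1 + (P.destabilizing κ).card * Θ) +
          Hm * jumpBase κ ^ (P.destabilizing κ).card) +
      η * N * (batchConst κ ^ 2 * (1 + levelConst κ)) *
        (nb * Θ ^ 2 + Θ * Hm * jumpBase κ ^ (P.destabilizing κ).card)) := by
  set D : ℕ → ℕ := fun b => P.fullLength κ T τ η K b with hD
  set q := P.batchBreaks κ T τ η K with hq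
  set u := (P.destabilizing κ).card with hu
  set v := fun b => P.excess κ T τ η K b ^ 4 with hv
  set c : ℕ → ℝ := fun t => P.cost t (closedLoop P.f (P.policy i) P.noise P.x0 t)
    (P.policy i (closedLoop P.f (P.policy i) P.noise P.x0 t)) with hcdef
  set A := (batchConst κ + compareConst κ) * (1 + levelConst κ) with hA
  set B := batchConst κ ^ 2 * (1 + levelConst κ) with hB
  -- The sum runs over `T + 1` indices, but batches starting after the horizon are empty; the
  -- indicator keeps them from paying `lam` or `Θ ^ 2`.
  set act : ℕ → ℝ := fun b => if (P.runState κ T τ η K b).time ≤ T then 1 else 0 with hact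
  have hb := batchConst_nonneg κ
  have hc := compareConst_nonneg κ
  have hl := levelConst_nonneg κ
  have hA0 : 0 ≤ A := by positivity
  have hB0 : 0 ≤ B := by positivity
  have hΘ0 : 0 ≤ Θ := (Nat.cast_nonneg _).trans (hΘ 0 (Nat.zero_le _))
  have hHm0 : 0 ≤ Hm := (κ.H_nonneg _).trans (hHm 0 (Nat.zero_le _))
  have hv0 : ∀ b, 0 ≤ v b := fun b => pow_nonneg (excess_nonneg b) 4
  have hcount : countBelow q (T + 1) ≤ u := (Nat.le_add_right _ _).trans
    (countBelow_breaks_add_card_le hP (T + 1) fun a ha => hK a (by omega))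
  have hsumv : ∑ b ∈ Finset.range (T + 1), v b ≤ jumpBase κ ^ u := sum_excess_pow_four_le hP hτ hK
  have hsumact : ∑ b ∈ Finset.range (T + 1), act b ≤ nb := by
    rw [hact, ← Finset.sum_filter, Finset.sum_const, nsmul_eq_mul, mul_one]
    exact hnb
  have hbrk : ∑ b ∈ Finset.range (T + 1), (if q b then (D b : ℝ) else 0) ≤ u * Θ :=
    (sum_fullLength_breaks_le (T + 1) fun a ha => hΘ a (by omega)).trans
      (mul_le_mul_of_nonneg_right (by exact_mod_cast hcount) hΘ0)
  have hnbrk : ∑ b ∈ Finset.range (T + 1), (if q b then 0 else (D b : ℝ)) ≤ T + 1 := by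
    have h1 := (sum_fullLength_not_breaks_le (P := P) (κ := κ) (T := T) (τ := τ)
      (η := η) (K := K) (T + 1)).trans (runState_time_le (T + 1))
    calc _ = ((∑ a ∈ Finset.range (T + 1), (if q a then 0 else D a) : ℕ) : ℝ) := by
          push_cast
          rfl
      _ ≤ ((T + 1 : ℕ) : ℝ) := by exact_mod_cast h1
      _ = _ := by push_cast; rfl
  have hsumD : ∑ b ∈ Finset.range (T + 1), (D b : ℝ) ≤ T + 1 + u * Θ := by
    refine le_trans (le_of_eq ?_) (add_le_add hnbrk hbrk)
    rw [← Finset.sum_add_distrib]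
    refine Finset.sum_congr rfl fun b _ => ?_
    split_ifs <;> simp
  have hstar : ∑ b ∈ Finset.range (T + 1), (if q b then 0 else
      ∑ j ∈ Finset.range (D b), c ((P.runState κ T τ η K b).time + j)) ≤ P.fixedCost T i := by
    have hc0 : ∀ t, 0 ≤ c t := fun t => hP.cost_nonneg _ _ _
    refine (sum_range_not_breaks_le hc0 (T + 1)).trans ?_
    exact Finset.sum_le_sum_of_subset_of_nonneg
      (Finset.range_subset_range.2 (runState_time_le (T + 1))) fun t _ _ => hP.cost_nonneg _ _ _
  have hHb : ∀ b, κ.H (D b) ≤ act b * lam + rho * D b := by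
    intro b
    by_cases h : (P.runState κ T τ η K b).time ≤ T
    · simp only [hact, if_pos h, one_mul]
      exact hH b
    · simp only [hact, if_neg h, hD, fullLength_eq_zero h, κ.H_zero]
      simp
  have hDb : ∀ b ≤ T, (D b : ℝ) ^ 2 ≤ act b * Θ ^ 2 := by
    intro b hbT
    by_cases h : (P.runState κ T τ η K b).time ≤ T
    · simp only [hact, if_pos h, one_mul]
      exact pow_le_pow_left₀ (Nat.cast_nonneg _) (hΘ b hbT) 2
    · simp only [hact, if_neg h, hD, fullLength_eq_zero h]
      simp
  have hterm : ∀ b ∈ Finset.range (T + 1),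
      P.batchCost κ T (τ b) (P.runState κ T τ η K b) i +
        η / 2 * ∑ j ∈ (P.runState κ T τ η K b).pool,
          P.batchCost κ T (τ b) (P.runState κ T τ η K b) j ^ 2 ≤
      (if q b then 0 else ∑ j ∈ Finset.range (D b), c ((P.runState κ T τ η K b).time + j)) +
      batchConst κ * (if q b then (D b : ℝ) else 0) +
      A * (act b * lam + rho * D b + Hm * v b) +
      η * N * B * (act b * Θ ^ 2 + Θ * Hm * v b) := by
    intro b hbT
    rw [Finset.mem_range, Nat.lt_succ_iff] at hbT
    have h1 := batchCost_benchmark_le hP hi b (hHm b hbT)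
    have h2 : A * (κ.H (D b) + Hm * v b) ≤ A * (act b * lam + rho * D b + Hm * v b) := by
      refine mul_le_mul_of_nonneg_left ?_ hA0
      linarith [hHb b]
    have h3 : ∑ j ∈ (P.runState κ T τ η K b).pool,
        P.batchCost κ T (τ b) (P.runState κ T τ η K b) j ^ 2 ≤
        N * (2 * B * (act b * Θ ^ 2 + Θ * Hm * v b)) := by
      have h4 : ∀ j ∈ (P.runState κ T τ η K b).pool,
          P.batchCost κ T (τ b) (P.runState κ T τ η K b) j ^ 2 ≤
          2 * B * (act b * Θ ^ 2 + Θ * Hm * v b) := by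
        intro j _
        refine (batchCost_sq_le hP b (hHm b hbT) (hΘ b hbT) j).trans ?_
        have h5 : 2 * batchConst κ ^ 2 * (1 + levelConst κ) = 2 * B := by rw [hB]; ring
        rw [h5]
        exact mul_le_mul_of_nonneg_left (add_le_add_left (hDb b hbT) _) (by positivity)
      refine (Finset.sum_le_card_nsmul _ _ _ h4).trans ?_
      rw [nsmul_eq_mul]
      refine mul_le_mul_of_nonneg_right ?_ ?_
      · exact_mod_cast (Finset.card_le_univ _).trans_eq (Fintype.card_fin N)
      · have ha : 0 ≤ act b := by simp only [hact]; split_ifs <;> norm_num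
        have := hv0 b
        positivity
    have h6 := mul_le_mul_of_nonneg_left h3 (show 0 ≤ η / 2 by positivity)
    have h7 : η / 2 * (N * (2 * B * (act b * Θ ^ 2 + Θ * Hm * v b))) =
        η * N * B * (act b * Θ ^ 2 + Θ * Hm * v b) := by ring
    rw [h7] at h6
    exact add_le_add (h1.trans (add_le_add_right h2 _)) h6
  refine (Finset.sum_le_sum hterm).trans ?_
  simp only [Finset.sum_add_distrib, ← Finset.mul_sum, ← Finset.sum_mul]
  have hηN : 0 ≤ η * N * B := by positivity
  have e1 := mul_le_mul_of_nonneg_left hbrk hb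
  have e2 : A * (∑ b ∈ Finset.range (T + 1), act b * lam + rho * ∑ b ∈ Finset.range (T + 1), (D b : ℝ)
      + Hm * ∑ b ∈ Finset.range (T + 1), v b) ≤
      A * (nb * lam + rho * (T + 1 + u * Θ) + Hm * jumpBase κ ^ u) := by
    rw [← Finset.sum_mul]
    gcongr
  have e3 : η * N * B * (∑ b ∈ Finset.range (T + 1), act b * Θ ^ 2 +
      Θ * Hm * ∑ b ∈ Finset.range (T + 1), v b) ≤
      η * N * B * (nb * Θ ^ 2 + Θ * Hm * jumpBase κ ^ u) := by
    rw [← Finset.sum_mul]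
    gcongr
  simp only [← Finset.sum_mul] at e2 e3
  linarith

end ControlProblem

/-! ### The polynomial batch lengths -/

section PolyBatch

variable {ν z M : ℝ}

theorem sqrt_le_polyBatch_succ (b : ℕ) :
    Real.sqrt ((ν * ((b + 1 : ℕ) : ℝ) + z) / M) ≤ polyBatch ν z M (b + 1) :=
  Nat.le_ceil _

theorem polyBatch_monotone (hν : 0 ≤ ν) (hM : 0 < M) : Monotone (polyBatch ν z M) := by
  refine monotone_nat_of_le_succ fun b => ?_
  cases b with
  | zero =>
    refine (Nat.floor_le_ceil _).trans (Nat.ceil_mono (Real.sqrt_le_sqrt ?_))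
    gcongr
    push_cast
    linarith
  | succ b =>
    refine Nat.ceil_mono (Real.sqrt_le_sqrt ?_)
    gcongr
    linarith

theorem sqrt_mul_sqrt_le_polyBatch (hν : 0 ≤ ν) (hM : 0 < M) (hz : 0 ≤ z) (b : ℕ) :
    Real.sqrt (ν / M) * Real.sqrt b ≤ polyBatch ν z M b := by
  cases b with
  | zero => simp
  | succ b =>
    refine le_trans ?_ (sqrt_le_polyBatch_succ b)
    rw [← Real.sqrt_mul (div_nonneg hν hM.le)]
    refine Real.sqrt_le_sqrt ?_
    rw [div_mul_eq_mul_div]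
    gcongr
    linarith

theorem polyBatch_sq_le (hν : 0 ≤ ν) (hM : 0 < M) (hz : 0 ≤ z) (b : ℕ) :
    (polyBatch ν z M b : ℝ) ^ 2 ≤ 2 * ((ν * b + z) / M) + 2 := by
  have hnn : ∀ c : ℕ, 0 ≤ (ν * c + z) / M := fun c => by positivity
  have key : (polyBatch ν z M b : ℝ) ≤ Real.sqrt ((ν * b + z) / M) + 1 := by
    cases b with
    | zero =>
      refine (Nat.floor_le (Real.sqrt_nonneg _)).trans ?_
      simp
    | succ b => exact (Nat.ceil_lt_add_one (Real.sqrt_nonneg _)).le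
  have h1 := pow_le_pow_left₀ (Nat.cast_nonneg _) key 2
  have h2 := Real.sq_sqrt (hnn b)
  nlinarith [sq_nonneg (Real.sqrt ((ν * b + z) / M) - 1)]

/-- From `a ≤ √m √a` one gets `m (m - 1) / 2 ≤ √m S`, and `m ≥ 2` gives `m ^ 2 ≤ 4 √m S`; square and
cancel `m`. -/
theorem pow_three_le_sum_sqrt_sq (m : ℕ) (hm : 2 ≤ m) :
    (m : ℝ) ^ 3 ≤ 16 * (∑ a ∈ Finset.range m, Real.sqrt a) ^ 2 := by
  set S := ∑ a ∈ Finset.range m, Real.sqrt a with hS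
  have hm' : (2 : ℝ) ≤ m := by exact_mod_cast hm
  have h1 : ∑ a ∈ Finset.range m, (a : ℝ) ≤ Real.sqrt m * S := by
    rw [hS, Finset.mul_sum]
    refine Finset.sum_le_sum fun a ha => ?_
    have ha' : (a : ℝ) ≤ m := by exact_mod_cast (Finset.mem_range.1 ha).le
    calc (a : ℝ) = Real.sqrt a * Real.sqrt a := (Real.mul_self_sqrt (Nat.cast_nonneg _)).symm
      _ ≤ _ := mul_le_mul_of_nonneg_right (Real.sqrt_le_sqrt ha') (Real.sqrt_nonneg _)
  have h2 : (∑ a ∈ Finset.range m, (a : ℝ)) * 2 = m * (m - 1) := by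
    have := Finset.sum_range_id_mul_two m
    have h3 : (((∑ a ∈ Finset.range m, a) * 2 : ℕ) : ℝ) = ((m * (m - 1) : ℕ) : ℝ) := by rw [this]
    push_cast [Nat.cast_sub (show 1 ≤ m by omega)] at h3
    exact h3
  have h4 : (m : ℝ) ^ 2 ≤ 4 * (Real.sqrt m * S) := by nlinarith
  have h5 := pow_le_pow_left₀ (by positivity) h4 2
  have h6 : (4 * (Real.sqrt m * S)) ^ 2 = m * (16 * S ^ 2) := by
    rw [mul_pow, mul_pow, Real.sq_sqrt (Nat.cast_nonneg _)]
    ring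
  rw [h6] at h5
  have h7 : ((m : ℝ) ^ 2) ^ 2 = m * m ^ 3 := by ring
  rw [h7] at h5
  exact le_of_mul_le_mul_left h5 (by linarith)

theorem index_le_of_sum_polyBatch_le {T X : ℝ} (hν : 0 < ν) (hM : 0 < M) (hz : 0 ≤ z)
    (hX : 1 ≤ X) (hXT : X ^ 3 = T ^ 2 * M) {m : ℕ}
    (h : ∑ a ∈ Finset.range m, (polyBatch ν z M a : ℝ) ≤ T) : (m : ℝ) ≤ (1 + 16 / ν) * X := by
  have hq : 0 < 16 / ν := by positivity
  rcases lt_or_ge m 2 with hm | hm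
  · have : (m : ℝ) ≤ 1 := by exact_mod_cast Nat.lt_succ_iff.1 hm
    nlinarith
  have h1 := pow_three_le_sum_sqrt_sq m hm
  set S := ∑ a ∈ Finset.range m, Real.sqrt a with hS
  have h2 : Real.sqrt (ν / M) * S ≤ T := by
    refine le_trans ?_ h
    rw [hS, Finset.mul_sum]
    exact Finset.sum_le_sum fun a _ => sqrt_mul_sqrt_le_polyBatch hν.le hM hz a
  have hS0 : 0 ≤ S := Finset.sum_nonneg fun a _ => Real.sqrt_nonneg _
  have h3 := pow_le_pow_left₀ (mul_nonneg (Real.sqrt_nonneg _) hS0) h2 2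
  rw [mul_pow, Real.sq_sqrt (by positivity)] at h3
  have h4 : ν * S ^ 2 ≤ X ^ 3 := by
    rw [hXT]
    rw [div_mul_eq_mul_div, div_le_iff₀ hM] at h3
    exact h3
  have h5 : (m : ℝ) ^ 3 ≤ 16 / ν * X ^ 3 := by
    rw [div_mul_eq_mul_div, le_div_iff₀ hν]
    nlinarith
  -- Avoids a cube root in the constant; the summand `1` also covers `m ≤ 1`.
  have h6 : 16 / ν ≤ (1 + 16 / ν) ^ 3 := by nlinarith [pow_pos hq 2, pow_pos hq 3]
  refine le_of_pow_le_pow_left₀ (n := 3) (by norm_num) (by positivity) ?_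
  rw [mul_pow]
  exact h5.trans (mul_le_mul_of_nonneg_right h6 (by positivity))

end PolyBatch

/-! ### Number and length of the batches under the tuning -/

namespace ControlProblem

variable {n m g N : ℕ} {P : ControlProblem n m g N} {κ : ModelConstants}
variable {ν ζ a₁ a₂ z η : ℝ} {T : ℕ} {istar : Fin N}

variable (P κ T) in
/-- The order `T^{2/3} N^{1/3} (|𝒰| + 1)^{1/3}` of the regret. -/
def regretScale : ℝ :=
  (T : ℝ) ^ (2 / 3 : ℝ) * (N : ℝ) ^ (1 / 3 : ℝ) *
    (((P.destabilizing κ).card : ℝ) + 1) ^ (1 / 3 : ℝ)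

theorem rpow_third_pow_three {x : ℝ} (hx : 0 ≤ x) : (x ^ (1 / 3 : ℝ)) ^ 3 = x := by
  rw [← Real.rpow_natCast, ← Real.rpow_mul hx]
  norm_num

theorem rpow_two_thirds_pow_three {x : ℝ} (hx : 0 ≤ x) : (x ^ (2 / 3 : ℝ)) ^ 3 = x ^ 2 := by
  rw [← Real.rpow_natCast, ← Real.rpow_mul hx, ← Real.rpow_natCast]
  norm_num

theorem regretScale_pow_three : P.regretScale κ T ^ 3 = (T : ℝ) ^ 2 * P.poolFactor κ := by
  have hu : (0 : ℝ) ≤ ((P.destabilizing κ).card : ℝ) + 1 := by positivity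
  rw [regretScale, mul_pow, mul_pow, rpow_two_thirds_pow_three (Nat.cast_nonneg _),
    rpow_third_pow_three (Nat.cast_nonneg _), rpow_third_pow_three hu, poolFactor, mul_assoc]

theorem one_le_poolFactor (i : Fin N) : 1 ≤ P.poolFactor κ := by
  have hN : (1 : ℝ) ≤ N := by exact_mod_cast i.pos
  have hu : (0 : ℝ) ≤ (P.destabilizing κ).card := Nat.cast_nonneg _
  unfold poolFactor
  nlinarith

theorem regretScale_nonneg : 0 ≤ P.regretScale κ T := by
  unfold regretScale
  positivity

theorem poolFactor_le_regretScale (hM : 1 ≤ P.poolFactor κ) (hT : P.poolFactor κ ≤ T) :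
    P.poolFactor κ ≤ P.regretScale κ T := by
  refine le_of_pow_le_pow_left₀ (n := 3) (by norm_num) regretScale_nonneg ?_
  rw [regretScale_pow_three, pow_succ]
  gcongr

theorem regretScale_le (hT : P.poolFactor κ ≤ T) :
    P.regretScale κ T ≤ T := by
  refine le_of_pow_le_pow_left₀ (n := 3) (by norm_num) (Nat.cast_nonneg _) ?_
  rw [regretScale_pow_three, pow_succ (T : ℝ) 2]
  gcongr

/-- The identity behind the choice of the rate: it makes `η N X` of order `M`. -/
theorem rateScale_mul (i : Fin N) (hT : 1 ≤ T) :
    P.rateScale κ T * N * P.regretScale κ T = P.poolFactor κ := by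
  have hN : (0 : ℝ) < N := by exact_mod_cast i.pos
  have hT' : (0 : ℝ) < T := by exact_mod_cast hT
  have hu : (0 : ℝ) < ((P.destabilizing κ).card : ℝ) + 1 := by positivity
  have h1 : (((P.destabilizing κ).card : ℝ) + 1) ^ (2 / 3 : ℝ) *
      (((P.destabilizing κ).card : ℝ) + 1) ^ (1 / 3 : ℝ) =
      ((P.destabilizing κ).card : ℝ) + 1 := by
    rw [← Real.rpow_add hu]
    norm_num
  have h2 : (0 : ℝ) < (T : ℝ) ^ (2 / 3 : ℝ) := by positivity
  have h3 : (0 : ℝ) < (N : ℝ) ^ (1 / 3 : ℝ) := by positivity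
  unfold rateScale regretScale poolFactor
  field_simp
  linear_combination h1

/-- The constant in the bound of the squared batch lengths. -/
def lengthConst (ν ζ : ℝ) : ℝ := 4 * ν + 34 + 2 * ζ

theorem Tuned.poolFactor_le (h : P.Tuned κ ν ζ a₁ a₂ T z η istar) : P.poolFactor κ ≤ T :=
  (le_max_right _ _).trans h.horizon

theorem Tuned.one_le_T (h : P.Tuned κ ν ζ a₁ a₂ T z η istar) : 1 ≤ T := by
  have := (one_le_poolFactor istar).trans h.poolFactor_le
  exact_mod_cast this

theorem Tuned.one_le_regretScale (h : P.Tuned κ ν ζ a₁ a₂ T z η istar) :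
    1 ≤ P.regretScale κ T :=
  (one_le_poolFactor istar).trans
    (poolFactor_le_regretScale (one_le_poolFactor istar) h.poolFactor_le)

theorem Tuned.tunedBatch_monotone (hν : 0 < ν) (_ : P.Tuned κ ν ζ a₁ a₂ T z η istar) :
    Monotone (P.tunedBatch κ ν z) :=
  polyBatch_monotone hν.le (zero_lt_one.trans_le (one_le_poolFactor istar))

/-- As `τ_1 / τ_0 ≥ 1`, the ratio condition gives `β(τ_0)² < 1/2 < (3/4)²`, and later batches are no
shorter. -/
theorem Tuned.beta_tunedBatch_le (hν : 0 < ν) (h : P.Tuned κ ν ζ a₁ a₂ T z η istar) (b : ℕ) :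
    κ.β (P.tunedBatch κ ν z b) ≤ 3 / 4 := by
  have hmono := h.tunedBatch_monotone hν
  refine (κ.β_antitone (hmono (Nat.zero_le b))).trans ?_
  have h0 : (0 : ℝ) < P.tunedBatch κ ν z 0 := by exact_mod_cast h.tau_pos
  have h1 : (P.tunedBatch κ ν z 0 : ℝ) ≤ P.tunedBatch κ ν z 1 := by
    exact_mod_cast hmono (Nat.zero_le 1)
  have h2 : 1 ≤ (P.tunedBatch κ ν z 1 : ℝ) / P.tunedBatch κ ν z 0 := (one_le_div h0).2 h1
  have h3 := h.tau_ratio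
  have h4 : 1 / (2 * Real.sqrt 2) ≤ 1 / 2 := by
    have : (1 : ℝ) ≤ Real.sqrt 2 := Real.one_le_sqrt.2 (by norm_num)
    gcongr
    linarith
  have h5 := le_mul_of_one_le_left (sq_nonneg (κ.β (P.tunedBatch κ ν z 0))) h2
  nlinarith [κ.β_nonneg (P.tunedBatch κ ν z 0)]

theorem card_destabilizing_le (i : Fin N) :
    ((P.destabilizing κ).card : ℝ) ≤ P.poolFactor κ := by
  have hN : (1 : ℝ) ≤ N := by exact_mod_cast i.pos
  have hu : (0 : ℝ) ≤ (P.destabilizing κ).card := Nat.cast_nonneg _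
  unfold poolFactor
  nlinarith

variable {K : ℕ → Fin N}

/-- Unbroken batches are limited by the time they consume, broken ones by `|𝒰| ≤ M ≤ X`; the latter
raise the constant from `1 + 16 / ν` to `2 + 16 / ν`. -/
theorem Tuned.index_le_of_active (hν : 0 < ν) (h : P.Tuned κ ν ζ a₁ a₂ T z η istar)
    (hK : ∀ b ≤ T, K b ∈ (P.runState κ T (P.tunedBatch κ ν z) η K b).pool) {b : ℕ} (hbT : b ≤ T)
    (hb : (P.runState κ T (P.tunedBatch κ ν z) η K b).time ≤ T) :
    (b : ℝ) ≤ (2 + 16 / ν) * P.regretScale κ T := by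
  have hM := one_le_poolFactor (P := P) (κ := κ) istar
  have h1 := (sum_tau_le_time (h.tunedBatch_monotone hν) b hb).trans hb
  set q := countBelow (P.batchBreaks κ T (P.tunedBatch κ ν z) η K) b with hq
  have h2 : ((b - q : ℕ) : ℝ) ≤ (1 + 16 / ν) * P.regretScale κ T := by
    refine index_le_of_sum_polyBatch_le (T := T) hν (zero_lt_one.trans_le hM) h.z_pos.le
      h.one_le_regretScale regretScale_pow_three ?_
    exact_mod_cast h1
  have h3 : q ≤ (P.destabilizing κ).card := (Nat.le_add_right _ _).trans
    (countBelow_breaks_add_card_le h.admissible b fun a ha => hK a (by omega))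
  have h4 : (q : ℝ) ≤ P.regretScale κ T := by
    have h5 : (q : ℝ) ≤ (P.destabilizing κ).card := by exact_mod_cast h3
    exact (h5.trans (card_destabilizing_le istar)).trans
      (poolFactor_le_regretScale hM h.poolFactor_le)
  have h6 : (b : ℝ) ≤ ((b - q : ℕ) : ℝ) + q := by exact_mod_cast le_tsub_add
  linarith

theorem Tuned.tunedBatch_sq_le (hν : 0 < ν) (h : P.Tuned κ ν ζ a₁ a₂ T z η istar) {b : ℕ}
    (hb : (b : ℝ) ≤ (2 + 16 / ν) * P.regretScale κ T) :
    (P.tunedBatch κ ν z b : ℝ) ^ 2 ≤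
      lengthConst ν ζ * (P.regretScale κ T / P.poolFactor κ) := by
  have hM := one_le_poolFactor (P := P) (κ := κ) istar
  have hM0 := zero_lt_one.trans_le hM
  have hX := poolFactor_le_regretScale hM h.poolFactor_le
  refine (polyBatch_sq_le hν.le hM0 h.z_pos.le b).trans ?_
  have hz : 0 ≤ ζ := by
    by_contra hc
    push Not at hc
    nlinarith [h.z_le, h.z_pos]
  have h1 : ν * b ≤ (2 * ν + 16) * P.regretScale κ T := by
    refine (mul_le_mul_of_nonneg_left hb hν.le).trans_eq ?_
    field_simp
  have h2 : z ≤ ζ * P.regretScale κ T := h.z_le.trans (mul_le_mul_of_nonneg_left hX hz)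
  have h3 : (ν * b + z) / P.poolFactor κ ≤
      ((2 * ν + 16) * P.regretScale κ T + ζ * P.regretScale κ T) / P.poolFactor κ := by
    gcongr
  have h4 : 1 ≤ P.regretScale κ T / P.poolFactor κ := (one_le_div hM0).2 hX
  have h5 : ((2 * ν + 16) * P.regretScale κ T + ζ * P.regretScale κ T) / P.poolFactor κ =
      (2 * ν + 16 + ζ) * (P.regretScale κ T / P.poolFactor κ) := by ring
  unfold lengthConst
  linarith

variable (P κ T) in
/-- A bound for the lengths of the batches. -/
def maxLength (L : ℝ) : ℝ := Real.sqrt (L * (P.regretScale κ T / P.poolFactor κ))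

theorem Tuned.fullLength_le (hν : 0 < ν) (h : P.Tuned κ ν ζ a₁ a₂ T z η istar)
    (hK : ∀ b ≤ T, K b ∈ (P.runState κ T (P.tunedBatch κ ν z) η K b).pool) {b : ℕ} (hbT : b ≤ T) :
    (P.fullLength κ T (P.tunedBatch κ ν z) η K b : ℝ) ≤ P.maxLength κ T (lengthConst ν ζ) := by
  by_cases hact : (P.runState κ T (P.tunedBatch κ ν z) η K b).time ≤ T
  · have h1 := h.tunedBatch_sq_le hν (h.index_le_of_active hν hK hbT hact)
    have h2 : (P.fullLength κ T (P.tunedBatch κ ν z) η K b : ℝ) ≤ P.tunedBatch κ ν z b := by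
      exact_mod_cast min_le_left _ _
    exact h2.trans (Real.le_sqrt_of_sq_le h1)
  · rw [fullLength_eq_zero hact, Nat.cast_zero]
    exact Real.sqrt_nonneg _

open Classical in
theorem Tuned.card_active_le (hν : 0 < ν) (h : P.Tuned κ ν ζ a₁ a₂ T z η istar)
    (hK : ∀ b ≤ T, K b ∈ (P.runState κ T (P.tunedBatch κ ν z) η K b).pool) :
    (((Finset.range (T + 1)).filter
      fun b => (P.runState κ T (P.tunedBatch κ ν z) η K b).time ≤ T).card : ℝ) ≤
      (3 + 16 / ν) * P.regretScale κ T := by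
  have hX := h.one_le_regretScale
  have hsub : (Finset.range (T + 1)).filter
      (fun b => (P.runState κ T (P.tunedBatch κ ν z) η K b).time ≤ T) ⊆
      Finset.range (⌊(2 + 16 / ν) * P.regretScale κ T⌋₊ + 1) := by
    intro b hb
    rw [Finset.mem_filter, Finset.mem_range] at hb
    rw [Finset.mem_range, Nat.lt_succ_iff]
    exact Nat.le_floor (h.index_le_of_active hν hK (by omega) hb.2)
  have h1 := Finset.card_le_card hsub
  rw [Finset.card_range] at h1
  have h2 : (⌊(2 + 16 / ν) * P.regretScale κ T⌋₊ : ℝ) ≤ (2 + 16 / ν) * P.regretScale κ T :=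
    Nat.floor_le (by positivity)
  calc _ ≤ ((⌊(2 + 16 / ν) * P.regretScale κ T⌋₊ + 1 : ℕ) : ℝ) := by exact_mod_cast h1
    _ ≤ _ := by
      push_cast
      linarith

/-- Sixth powers clear all roots: `Θ⁶ = L³ (X / M)³` and `X³ = T² M`, so `M ≥ 1` suffices. -/
theorem Tuned.maxLength_le {L : ℝ} (hL : 1 ≤ L) (h : P.Tuned κ ν ζ a₁ a₂ T z η istar) :
    P.maxLength κ T L ≤ L * (T : ℝ) ^ (1 / 3 : ℝ) := by
  have hM1 := one_le_poolFactor (P := P) (κ := κ) istar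
  have hM0 := zero_lt_one.trans_le hM1
  have hX := zero_lt_one.trans_le h.one_le_regretScale
  refine le_of_pow_le_pow_left₀ (n := 6) (by norm_num) (by positivity) ?_
  have h1 : P.maxLength κ T L ^ 6 = L ^ 3 * (P.regretScale κ T / P.poolFactor κ) ^ 3 := by
    rw [show (6 : ℕ) = 2 * 3 from rfl, pow_mul, maxLength, Real.sq_sqrt (by positivity), mul_pow]
  have h2 : (P.regretScale κ T / P.poolFactor κ) ^ 3 ≤ (T : ℝ) ^ 2 := by
    rw [div_pow, regretScale_pow_three, div_le_iff₀ (by positivity)]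
    refine mul_le_mul_of_nonneg_left ?_ (by positivity)
    exact le_self_pow₀ hM1 (by norm_num)
  have h3 : (L * (T : ℝ) ^ (1 / 3 : ℝ)) ^ 6 = L ^ 6 * (T : ℝ) ^ 2 := by
    rw [mul_pow, show (6 : ℕ) = 3 * 2 from rfl, pow_mul ((T : ℝ) ^ (1 / 3 : ℝ)),
      rpow_third_pow_three (Nat.cast_nonneg _)]
  rw [h1, h3]
  exact mul_le_mul (pow_le_pow_right₀ hL (by norm_num)) h2 (by positivity) (by positivity)

theorem Tuned.eta_bounds (ha₁ : 0 < a₁) (h : P.Tuned κ ν ζ a₁ a₂ T z η istar) :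
    0 < η ∧ a₁ * P.poolFactor κ ≤ η * N * P.regretScale κ T ∧
      η * N * P.regretScale κ T ≤ a₂ * P.poolFactor κ := by
  have hM1 := one_le_poolFactor (P := P) (κ := κ) istar
  have hX := zero_lt_one.trans_le h.one_le_regretScale
  have hNX : 0 ≤ N * P.regretScale κ T := by positivity
  have hrate := rateScale_mul (P := P) (κ := κ) istar h.one_le_T
  have hrs : 0 < P.rateScale κ T := by
    by_contra hc
    push Not at hc
    have := mul_nonpos_of_nonpos_of_nonneg hc hNX
    linarith
  refine ⟨(mul_pos ha₁ hrs).trans_le h.rate_ge, ?_, ?_⟩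
  · have h1 := mul_le_mul_of_nonneg_right h.rate_ge hNX
    rw [← hrate]
    linarith
  · have h1 := mul_le_mul_of_nonneg_right h.rate_le hNX
    rw [← hrate]
    linarith

/-! ### Assembling the regret bound -/

theorem Tuned.regret_le_raw (hν : 0 < ν) (hζ : 0 < ζ) (ha₁ : 0 < a₁)
    (h : P.Tuned κ ν ζ a₁ a₂ T z η istar) {lam rho : ℝ} (hlam : 0 ≤ lam) (hrho : 0 ≤ rho)
    (hH : ∀ D : ℕ, D ≤ T + 1 → κ.H D ≤ lam + rho * D) :
    P.regret κ T (P.tunedBatch κ ν z) η istar ≤ Real.log N / η +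
      (batchConst κ * ((P.destabilizing κ).card * P.maxLength κ T (lengthConst ν ζ)) +
      (batchConst κ + compareConst κ) * (1 + levelConst κ) *
        ((3 + 16 / ν) * P.regretScale κ T * lam + rho * (T + 1 +
          (P.destabilizing κ).card * P.maxLength κ T (lengthConst ν ζ)) +
          κ.H ⌈lengthConst ν ζ * (T : ℝ) ^ (1 / 3 : ℝ)⌉₊ *
            jumpBase κ ^ (P.destabilizing κ).card) +
      η * N * (batchConst κ ^ 2 * (1 + levelConst κ)) *
        ((3 + 16 / ν) * P.regretScale κ T * P.maxLength κ T (lengthConst ν ζ) ^ 2 +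
          P.maxLength κ T (lengthConst ν ζ) * κ.H ⌈lengthConst ν ζ * (T : ℝ) ^ (1 / 3 : ℝ)⌉₊ *
            jumpBase κ ^ (P.destabilizing κ).card)) := by
  classical
  have hη := (h.eta_bounds ha₁).1
  have hL1 : 1 ≤ lengthConst ν ζ := by rw [lengthConst]; linarith
  have hX := zero_lt_one.trans_le h.one_le_regretScale
  refine regret_le_of_forall_path h.admissible hη (Finset.mem_filter.1 h.best.1).2.1 ?_ ?_
  · have h1 : 0 ≤ P.maxLength κ T (lengthConst ν ζ) := Real.sqrt_nonneg _
    have h2 := batchConst_nonneg κ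
    have h3 := compareConst_nonneg κ
    have h4 := levelConst_nonneg κ
    have h5 := κ.H_nonneg ⌈lengthConst ν ζ * (T : ℝ) ^ (1 / 3 : ℝ)⌉₊
    have h6 := zero_le_one.trans (one_le_jumpBase κ)
    positivity
  · intro K hK
    refine path_cost_le h.admissible h.best.1 hη.le (h.beta_tunedBatch_le hν) hK hlam hrho
      (fun b hbT => κ.H_mono ?_) (fun b hbT => h.fullLength_le hν hK hbT)
      (h.card_active_le hν hK) (fun b => hH _ ((min_le_right _ _).trans (Nat.sub_le _ _)))
    have h1 := (h.fullLength_le hν hK hbT).trans ((h.maxLength_le hL1).trans (Nat.le_ceil _))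
    exact_mod_cast h1

/-- Since `N ≤ M`, the lower bound on the rate gives `a₁ ≤ η X`, so `1 / η ≤ X / a₁`. -/
theorem log_div_le {a₁ X M η N T : ℝ} (ha₁ : 0 < a₁) (hX : 0 ≤ X) (hη : 0 < η) (hM : 0 < M)
    (hN : 1 ≤ N) (hNM : N ≤ M) (hMT : M ≤ T) (h : a₁ * M ≤ η * N * X) :
    Real.log N / η ≤ 1 / a₁ * (Real.log T * X) := by
  rw [div_le_iff₀ hη]
  have h1 : Real.log N ≤ Real.log T := Real.log_le_log (by linarith) (hNM.trans hMT)
  have hlogT : 0 ≤ Real.log T := (Real.log_nonneg hN).trans h1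
  have h2 : a₁ ≤ η * X := by
    have h3 := mul_le_mul_of_nonneg_left hNM (show 0 ≤ η * X by positivity)
    have h4 : a₁ * M ≤ η * X * M := by linarith
    exact le_of_mul_le_mul_right h4 hM
  have h3 : 1 ≤ 1 / a₁ * (η * X) := by
    rw [one_div, inv_mul_eq_div]
    exact (one_le_div ha₁).2 h2
  have h4 := le_mul_of_one_le_right hlogT h3
  linarith

/-- The orders of the terms of the regret bound under the tuning of batch lengths and rate. -/
theorem tuned_terms_le {a₂ L b₀ A B k X M u Θ r T lam rho Hm V : ℝ} (hb : 0 ≤ b₀)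
    (hA0 : 0 ≤ A) (hB0 : 0 ≤ B) (hk0 : 0 ≤ k) (hL1 : 1 ≤ L) (hM0 : 0 < M)
    (hMX : M ≤ X) (hXT : X ≤ T) (hT1 : 1 ≤ T) (huM : u ≤ M) (hr : 0 ≤ r)
    (hrX : r * X ≤ a₂ * M) (hΘ : 1 ≤ Θ) (hΘsq : Θ ^ 2 = L * (X / M))
    (hrho : 0 ≤ rho) (hHm : 0 ≤ Hm) (hV : 0 ≤ V) :
    b₀ * (u * Θ) + A * (k * X * lam + rho * (T + 1 + u * Θ) + Hm * V) +
        r * B * (k * X * Θ ^ 2 + Θ * Hm * V) ≤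
      b₀ * L * X + A * k * (lam * X) + A * (2 + L) * (rho * T) + A * (Hm * V) +
        a₂ * B * k * L * X + a₂ * B * L * (Hm * V) := by
  have hX0 : 0 < X := hM0.trans_le hMX
  have hL0 : 0 ≤ L := zero_le_one.trans hL1
  have hΘ0 : 0 ≤ Θ := zero_le_one.trans hΘ
  have hΘle : Θ ≤ Θ ^ 2 := le_self_pow₀ hΘ (by norm_num)
  have hMΘ : M * Θ ^ 2 = L * X := by
    rw [hΘsq]
    field_simp
  -- `Θ ≥ 1` allows `Θ ≤ Θ ^ 2`, and `M Θ ^ 2 = L X` by the definition of `Θ`.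
  have huΘ : u * Θ ≤ L * X := by
    rw [← hMΘ]
    exact mul_le_mul huM hΘle hΘ0 hM0.le
  have e1 : b₀ * (u * Θ) ≤ b₀ * (L * X) := mul_le_mul_of_nonneg_left huΘ hb
  have e2 : A * (rho * (T + 1 + u * Θ)) ≤ A * (rho * ((2 + L) * T)) := by
    have h1 := mul_le_mul_of_nonneg_left hXT hL0
    have h2 : T + 1 + u * Θ ≤ (2 + L) * T := by linarith
    exact mul_le_mul_of_nonneg_left (mul_le_mul_of_nonneg_left h2 hrho) hA0
  have hrΘ : r * Θ ^ 2 ≤ a₂ * L := by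
    have h1 : r * Θ ^ 2 = r * X * (L / M) := by
      rw [hΘsq]
      ring
    rw [h1]
    refine (mul_le_mul_of_nonneg_right hrX (div_nonneg hL0 hM0.le)).trans_eq ?_
    field_simp
  have e3 := mul_le_mul_of_nonneg_right hrΘ (mul_nonneg (mul_nonneg hB0 hk0) hX0.le)
  have e4 := mul_le_mul_of_nonneg_right ((mul_le_mul_of_nonneg_left hΘle hr).trans hrΘ)
    (mul_nonneg hB0 (mul_nonneg hHm hV))
  linarith

theorem collect_constants {c₁ c₂ c₃ c₄ c₅ c₆ c₇ l X lam y w : ℝ} (h₁ : 0 ≤ c₁) (h₂ : 0 ≤ c₂)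
    (h₃ : 0 ≤ c₃) (h₄ : 0 ≤ c₄) (h₅ : 0 ≤ c₅) (h₆ : 0 ≤ c₆) (h₇ : 0 ≤ c₇) (hl : 0 ≤ l)
    (hX : 0 ≤ X) (hlam : 0 ≤ lam) (hy : 0 ≤ y) (hw : 0 ≤ w) :
    c₁ * (l * X) + (c₂ * X + c₃ * (lam * X) + c₄ * w + c₅ * y + c₆ * X + c₇ * y) ≤
      (c₁ + c₂ + c₃ + c₄ + c₅ + c₆ + c₇) * (1 + l + lam) * X +
        (c₁ + c₂ + c₃ + c₄ + c₅ + c₆ + c₇) * y + (c₁ + c₂ + c₃ + c₄ + c₅ + c₆ + c₇) * w := by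
  have f1 : (c₅ + c₇) * y ≤ (c₁ + c₂ + c₃ + c₄ + c₅ + c₆ + c₇) * y :=
    mul_le_mul_of_nonneg_right (by linarith) hy
  have f2 : c₄ * w ≤ (c₁ + c₂ + c₃ + c₄ + c₅ + c₆ + c₇) * w :=
    mul_le_mul_of_nonneg_right (by linarith) hw
  have f3 : c₁ * (l * X) ≤ (c₁ + c₂ + c₃ + c₄ + c₅ + c₆ + c₇) * (l * X) :=
    mul_le_mul_of_nonneg_right (by linarith) (mul_nonneg hl hX)
  have f4 : c₃ * (lam * X) ≤ (c₁ + c₂ + c₃ + c₄ + c₅ + c₆ + c₇) * (lam * X) :=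
    mul_le_mul_of_nonneg_right (by linarith) (mul_nonneg hlam hX)
  have f5 : (c₂ + c₆) * X ≤ (c₁ + c₂ + c₃ + c₄ + c₅ + c₆ + c₇) * X :=
    mul_le_mul_of_nonneg_right (by linarith) hX
  linarith

/-- The regret bound in terms of a bound on `H` by an affine function. -/
theorem regret_le_of_H_le (κ : ModelConstants) {ν ζ a₁ a₂ : ℝ} (hν : 0 < ν) (hζ : 0 < ζ)
    (ha₁ : 0 < a₁) (ha₂ : a₁ ≤ a₂) :
    ∃ C : ℝ, 0 ≤ C ∧ ∀ (n m g N : ℕ) (P : ControlProblem n m g N) (T : ℕ) (z η : ℝ)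
      (istar : Fin N), P.Tuned κ ν ζ a₁ a₂ T z η istar → ∀ lam rho : ℝ, 0 ≤ lam → 0 ≤ rho →
      (∀ D : ℕ, D ≤ T + 1 → κ.H D ≤ lam + rho * D) →
      P.regret κ T (P.tunedBatch κ ν z) η istar ≤
        C * (1 + Real.log T + lam) * P.regretScale κ T +
        C * (κ.H ⌈lengthConst ν ζ * (T : ℝ) ^ (1 / 3 : ℝ)⌉₊ *
          Real.exp (Real.log (jumpBase κ) * ((P.destabilizing κ).card : ℝ))) +
        C * (rho * T) := by
  have hL1 : 1 ≤ lengthConst ν ζ := by rw [lengthConst]; linarith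
  have hL0 := zero_le_one.trans hL1
  have hb := batchConst_nonneg κ
  have hl := levelConst_nonneg κ
  have hA0 : 0 ≤ (batchConst κ + compareConst κ) * (1 + levelConst κ) :=
    mul_nonneg (add_nonneg hb (compareConst_nonneg κ)) (by linarith)
  have hB0 : 0 ≤ batchConst κ ^ 2 * (1 + levelConst κ) := mul_nonneg (sq_nonneg _) (by linarith)
  have ha : 0 ≤ a₂ := ha₁.le.trans ha₂
  have hk0 : 0 ≤ 3 + 16 / ν := by positivity
  generalize hA : (batchConst κ + compareConst κ) * (1 + levelConst κ) = A at hA0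
  generalize hB : batchConst κ ^ 2 * (1 + levelConst κ) = B at hB0
  generalize hk : 3 + 16 / ν = k at hk0
  refine ⟨1 / a₁ + batchConst κ * lengthConst ν ζ + A * k + A * (2 + lengthConst ν ζ) + A +
    a₂ * B * k * lengthConst ν ζ + a₂ * B * lengthConst ν ζ, by positivity, ?_⟩
  intro n m g N P T z η istar h lam rho hlam hrho hH
  have hM1 := one_le_poolFactor (P := P) (κ := κ) istar
  have hM0 := zero_lt_one.trans_le hM1
  have hMX := poolFactor_le_regretScale hM1 h.poolFactor_le
  have hXT := regretScale_le h.poolFactor_le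
  have hT1 : (1 : ℝ) ≤ T := by exact_mod_cast h.one_le_T
  have hN1 : (1 : ℝ) ≤ N := by exact_mod_cast istar.pos
  have hNM : (N : ℝ) ≤ P.poolFactor κ :=
    le_mul_of_one_le_right (Nat.cast_nonneg _) (le_add_of_nonneg_left (Nat.cast_nonneg _))
  have hXM : 1 ≤ P.regretScale κ T / P.poolFactor κ := (one_le_div hM0).2 hMX
  have hX0 := zero_le_one.trans h.one_le_regretScale
  obtain ⟨hη, hη1, hη2⟩ := h.eta_bounds ha₁
  have hJ := one_le_jumpBase κ
  have hV : Real.exp (Real.log (jumpBase κ) * ((P.destabilizing κ).card : ℝ)) =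
      jumpBase κ ^ (P.destabilizing κ).card := by
    rw [mul_comm, Real.exp_nat_mul, Real.exp_log (by linarith)]
  have hV0 : 0 ≤ jumpBase κ ^ (P.destabilizing κ).card := pow_nonneg (by linarith) _
  have hHm := κ.H_nonneg ⌈lengthConst ν ζ * (T : ℝ) ^ (1 / 3 : ℝ)⌉₊
  have hregret := h.regret_le_raw hν hζ ha₁ hlam hrho hH
  rw [hA, hB, hk] at hregret
  rw [hV]
  have hΘ : 1 ≤ P.maxLength κ T (lengthConst ν ζ) := by
    rw [maxLength, Real.one_le_sqrt]
    exact one_le_mul_of_one_le_of_one_le hL1 hXM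
  refine (hregret.trans (add_le_add
    (log_div_le ha₁ hX0 hη hM0 hN1 hNM h.poolFactor_le hη1)
    (tuned_terms_le hb hA0 hB0 hk0 hL1 hM0 hMX hXT hT1 (card_destabilizing_le istar)
      (mul_nonneg hη.le (Nat.cast_nonneg _)) hη2 hΘ
      (Real.sq_sqrt (mul_nonneg hL0 (zero_le_one.trans hXM))) hrho hHm hV0))).trans ?_
  exact collect_constants (by positivity) (by positivity) (by positivity) (by positivity) hA0
    (by positivity) (by positivity) (Real.log_nonneg hT1) hX0 hlam (mul_nonneg hHm hV0)
    (mul_nonneg hrho (Nat.cast_nonneg _))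

end ControlProblem

/-! ### Asymptotics -/

theorem ModelConstants.H_isLittleO (κ : ModelConstants) :
    κ.H =o[atTop] (fun t : ℕ => (t : ℝ)) := by
  refine (isLittleO_iff_tendsto' ?_).2 ?_
  · filter_upwards [eventually_gt_atTop 0] with t ht h0
    exact absurd h0 (by positivity)
  · refine κ.β_tendsto.cesaro.congr fun t => ?_
    rw [ModelConstants.H, div_eq_inv_mul]

/-- Batches have length `O(T^{1/3})`, so sublinearity of `H` along this scale yields the factor of
the exponential term. -/
theorem ModelConstants.H_ceil_isLittleO (κ : ModelConstants) {L : ℝ} (hL : 1 ≤ L) :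
    (fun T : ℕ => κ.H ⌈L * (T : ℝ) ^ (1 / 3 : ℝ)⌉₊) =o[atTop]
      (fun T : ℕ => (T : ℝ) ^ (1 / 3 : ℝ)) := by
  have h1 : Tendsto (fun T : ℕ => (T : ℝ) ^ (1 / 3 : ℝ)) atTop atTop :=
    (tendsto_rpow_atTop (by norm_num)).comp tendsto_natCast_atTop_atTop
  have h2 : Tendsto (fun T : ℕ => ⌈L * (T : ℝ) ^ (1 / 3 : ℝ)⌉₊) atTop atTop :=
    tendsto_nat_ceil_atTop.comp (h1.const_mul_atTop (by linarith))
  refine (κ.H_isLittleO.comp_tendsto h2).trans_isBigO ?_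
  refine IsBigO.of_bound (L + 1) ?_
  filter_upwards [h1.eventually_ge_atTop 1] with T hT
  have h3 := (Nat.ceil_lt_add_one (show 0 ≤ L * (T : ℝ) ^ (1 / 3 : ℝ) by positivity)).le
  rw [Function.comp_apply, Real.norm_of_nonneg (Nat.cast_nonneg _), Real.norm_of_nonneg (by positivity)]
  linarith

theorem sum_Icc_one_div_le (D : ℕ) : ∑ i ∈ Finset.Icc 1 D, 1 / (i : ℝ) ≤ 1 + Real.log D := by
  refine le_trans (le_of_eq ?_) (harmonic_le_one_add_log D)
  rw [harmonic_eq_sum_Icc]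
  push_cast
  simp

theorem mainTheorem7 (κ : ModelConstants) (ν ζ a₁ a₂ : ℝ) (hν : 0 < ν) (hζ : 0 < ζ)
    (ha₁ : 0 < a₁) (ha₂ : a₁ ≤ a₂) :
    (∃ (C : ℝ) (p : ℕ) (c : ℝ) (r₁ r₂ : ℕ → ℝ),
      r₁ =o[atTop] (fun T : ℕ => (T : ℝ) ^ (1 / 3 : ℝ)) ∧
      r₂ =o[atTop] (fun T : ℕ => (T : ℝ)) ∧
      ∀ (n m g N : ℕ) (P : ControlProblem n m g N) (T : ℕ) (z η : ℝ) (istar : Fin N),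
        P.Tuned κ ν ζ a₁ a₂ T z η istar →
        P.regret κ T (P.tunedBatch κ ν z) η istar ≤
          C * (1 + Real.log T) ^ p * ((T : ℝ) ^ (2 / 3 : ℝ) * (N : ℝ) ^ (1 / 3 : ℝ) *
            (((P.destabilizing κ).card : ℝ) + 1) ^ (1 / 3 : ℝ)) +
          r₁ T * Real.exp (c * ((P.destabilizing κ).card : ℝ)) + r₂ T) ∧
    ((∃ h : ℝ, ∀ t : ℕ, 1 ≤ t → κ.H t ≤ h * ∑ i ∈ Finset.Icc 1 t, 1 / (i : ℝ)) →
      ∃ (C : ℝ) (p : ℕ) (c : ℝ) (r₁ : ℕ → ℝ),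
        r₁ =o[atTop] (fun T : ℕ => (T : ℝ) ^ (1 / 3 : ℝ)) ∧
        ∀ (n m g N : ℕ) (P : ControlProblem n m g N) (T : ℕ) (z η : ℝ) (istar : Fin N),
          P.Tuned κ ν ζ a₁ a₂ T z η istar →
          P.regret κ T (P.tunedBatch κ ν z) η istar ≤
            C * (1 + Real.log T) ^ p * ((T : ℝ) ^ (2 / 3 : ℝ) * (N : ℝ) ^ (1 / 3 : ℝ) *
              (((P.destabilizing κ).card : ℝ) + 1) ^ (1 / 3 : ℝ)) +
            r₁ T * Real.exp (c * ((P.destabilizing κ).card : ℝ))) := by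
  obtain ⟨C, hC, hmain⟩ := ControlProblem.regret_le_of_H_le κ hν hζ ha₁ ha₂
  set L := ControlProblem.lengthConst ν ζ with hL
  have hL1 : 1 ≤ L := by rw [hL, ControlProblem.lengthConst]; linarith
  have hr₁ : (fun T : ℕ => C * κ.H ⌈L * (T : ℝ) ^ (1 / 3 : ℝ)⌉₊) =o[atTop]
      (fun T : ℕ => (T : ℝ) ^ (1 / 3 : ℝ)) := (κ.H_ceil_isLittleO hL1).const_mul_left C
  constructor
  -- The cut-off `⌈log T⌉` tends to infinity, so `β` there vanishes and `r₂` is `o(T)`; yet it costs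
  -- only one logarithm in front of `X`.
  · refine ⟨2 * C, 1, Real.log (ControlProblem.jumpBase κ), _,
      fun T : ℕ => C * (κ.β ⌈Real.log T⌉₊ * T), hr₁, ?_, ?_⟩
    · have h1 : Tendsto (fun T : ℕ => κ.β ⌈Real.log T⌉₊) atTop (nhds 0) :=
        κ.β_tendsto.comp (tendsto_nat_ceil_atTop.comp
          (Real.tendsto_log_atTop.comp tendsto_natCast_atTop_atTop))
      have h2 := ((isLittleO_one_iff ℝ).2 h1).mul_isBigO
        (isBigO_refl (fun T : ℕ => (T : ℝ)) atTop)
      simp only [one_mul] at h2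
      exact h2.const_mul_left C
    · intro n m g N P T z η istar h
      have hT1 : (1 : ℝ) ≤ T := by exact_mod_cast h.one_le_T
      have hlog := Real.log_nonneg hT1
      have h1 := hmain n m g N P T z η istar h ⌈Real.log T⌉₊ (κ.β ⌈Real.log T⌉₊)
        (Nat.cast_nonneg _) (κ.β_nonneg _) fun D _ => by
          rw [mul_comm]
          exact κ.H_le_add_mul _ _
      rw [← mul_assoc C] at h1
      refine h1.trans ?_
      have h2 := (Nat.ceil_lt_add_one hlog).le
      have h3 : C * (1 + Real.log T + ⌈Real.log T⌉₊) ≤ 2 * C * (1 + Real.log T) ^ 1 := by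
        have := mul_le_mul_of_nonneg_left h2 hC
        rw [pow_one]
        linarith
      exact add_le_add_left (add_le_add_left
        (mul_le_mul_of_nonneg_right h3 ControlProblem.regretScale_nonneg) _) _
  · rintro ⟨c₀, hc₀⟩
    refine ⟨C * (1 + 2 * |c₀|), 1, Real.log (ControlProblem.jumpBase κ), _, hr₁, ?_⟩
    intro n m g N P T z η istar h
    have hT1 : (1 : ℝ) ≤ T := by exact_mod_cast h.one_le_T
    have hlog := Real.log_nonneg hT1
    -- With `D ≤ T + 1 ≤ 2 T` the harmonic sum is at most `1 + log (2 T) ≤ 2 + log T`, so `rho = 0`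
    -- works and the `o(T)` term disappears.
    have h1 := hmain n m g N P T z η istar h (|c₀| * (2 + Real.log T)) 0 (by positivity) le_rfl
      fun D hD => by
        rw [zero_mul, add_zero]
        rcases Nat.eq_zero_or_pos D with rfl | hD0
        · rw [κ.H_zero]
          positivity
        have hs : 0 ≤ ∑ i ∈ Finset.Icc 1 D, 1 / (i : ℝ) :=
          Finset.sum_nonneg fun i _ => by positivity
        refine (hc₀ D hD0).trans ((mul_le_mul_of_nonneg_right (le_abs_self c₀) hs).trans ?_)
        refine mul_le_mul_of_nonneg_left ((sum_Icc_one_div_le D).trans ?_) (abs_nonneg _)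
        have hD' : (D : ℝ) ≤ 2 * T := by
          have : (D : ℝ) ≤ T + 1 := by exact_mod_cast hD
          linarith
        have h2 := Real.log_le_log (by exact_mod_cast hD0) hD'
        rw [Real.log_mul (by norm_num) (by linarith)] at h2
        have h3 : Real.log 2 ≤ 1 := Real.log_two_lt_d9.le.trans (by norm_num)
        linarith
    rw [← mul_assoc C] at h1
    refine h1.trans ?_
    have h3 : C * (1 + Real.log T + |c₀| * (2 + Real.log T)) ≤
        C * (1 + 2 * |c₀|) * (1 + Real.log T) ^ 1 := by
      rw [pow_one, mul_assoc]
      refine mul_le_mul_of_nonneg_left ?_ hC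
      nlinarith [mul_nonneg (abs_nonneg c₀) hlog]
    rw [zero_mul, mul_zero, add_zero]
    exact add_le_add_left
      (mul_le_mul_of_nonneg_right h3 ControlProblem.regretScale_nonneg) _

end
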